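/- Conventions. A directed graph $E=(E^0,E^1,r,s)$ has countable sets $E^0$ (vertices), $E^1$ (edges) and range and source maps $r,s:E^1\to E^0$. A vertex $v$ is singular if $r^{-1}(v)$ is empty or infinite. A path is a finite or infinite sequence of edges $\mu=\mu_1\mu_2\cdots$ with $s(\mu_i)=r(\mu_{i+1})$; put $r(\mu)=r(\mu_1)$ and, for finite $\mu$ of length $|\mu|\ge 1$, $s(\mu)=s(\mu_{|\mu|})$; vertices $v$ are paths of length $0$ with $r(v)=s(v)=v$. $E^*$ is the set of finite paths. A cycle is a finite path $\alpha$ with $|\alpha|\ge1$, $s(\alpha)=r(\alpha)$ and $s(\alpha_i)\ne s(\alpha_j)$ for $i\neq j$; a graph or path is acyclic if it contains no cycle. A head is an acyclic infinite path $x=x_1x_2\cdots$ such that each $r(x_i)$ receives only the edge $x_i$ and each $s(x_i)$ emits only the edge $x_i$. Let $R$ be a commutative ring with identity. The Leavitt path algebra $L_R(E)$ is the universal (not necessarily unital) associative $R$-algebra generated by $\{p_v,s_e,s_{e^*}: v\in E^0,\ e\in E^1\}$, where the $p_v$ are mutually orthogonal idempotents, $p_{r(e)}s_e=s_e=s_ep_{s(e)}$,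 $p_{s(e)}s_{e^*}=s_{e^*}=s_{e^*}p_{r(e)}$, $s_{e^*}s_f=\delta_{e,f}p_{s(e)}$, and $p_v=\sum_{r(e)=v}s_es_{e^*}$ for every non-singular $v$. For $\mu\in E^*$ with $|\mu|\ge 1$ put $s_\mu=s_{\mu_1}\cdots s_{\mu_{|\mu|}}$ and $s_{\mu^*}=s_{\mu_{|\mu|}^*}\cdots s_{\mu_1^*}$; for a vertex $v$ put $s_v=s_{v^*}=p_v$. Two $R$-algebras $A,B$ are Morita equivalent if there is a surjective Morita context between them: an $A$–$B$-bimodule $M$ and a $B$–$A$-bimodule $N$ (with $AM=M=MB$, $BN=N=NA$) and surjective bimodule homomorphisms $\Psi:M\otimes_BN\to A$, $\Phi:N\otimes_AM\to B$ with $\Psi(m\otimes n)m'=m\,\Phi(n\otimes m')$ and $\Phi(n\otimes m)n'=n\,\Psi(m\otimes n')$. Theorem (algebraic version of the Crisp–Gow theorem). Let $R$ be a commutative ring with identity and let $E$ be a directed graph with no heads. Suppose that $G^0\subset E^0$ contains the singular vertices of $E$, and that the subgraph $T$ of $E$ defined by $$T^0:=E^0\setminus G^0,\qquad T^1:=\{e\in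 E^1: s(e),r(e)\in T^0\}$$ is acyclic. Suppose that (T1) each vertex in $G^0$ is the range of at most one infinite path $x$ in $E$ such that $s(x_i)\in T^0$ for all $i\ge1$; and that for each infinite path $y$ in $T$, (T2) there is a path in $E$ from $r(y)$ to a vertex in $G^0$, that is, some $\alpha\in E^*$ with $s(\alpha)=r(y)$ and $r(\alpha)\in G^0$; (T3) $|s^{-1}(r(y_i))|=1$ for all $i$; (T4) if $e\in E^1$ and $s(e)=r(y)$, then $|r^{-1}(r(e))|<\infty$. Let $G$ be the graph with vertex set $G^0$ and one edge $e_\beta$ for each $\beta\in E^*$ of length at least $1$ with $s(\beta),r(\beta)\in G^0$ and $s(\beta_i)\in T^0$ for $1\le i<|\beta|$, where $s(e_\beta)=s(\beta)$ and $r(e_\beta)=r(\beta)$. Then $L_R(G)$ is Morita equivalent to $L_R(E)$. Moreover, let $M=\operatorname{span}_R\{s_\mu s_{\nu^*}:\mu,\nu\in E^*,\ r(\mu)\in G^0\}$ and $M^*=\operatorname{span}_R\{s_\mu s_{\nu^*}:\mu,\nu\in E^*,\ r(\nu)\in G^0\}$, and write $XY$ for the $R$-span of all products $xy$ with $x\in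 X$, $y\in Y$. Then $G^0$ is full, i.e. $M^*M=L_R(E)$, and there is an injective $R$-algebra homomorphism $\phi:L_R(G)\to L_R(E)$ with range $MM^*$ which, writing $q_v,t_e,t_{e^*}$ for the generators of $L_R(G)$, satisfies $\phi(q_v)=p_v$, $\phi(t_{e_\beta})=s_\beta$ and $\phi(t_{e_\beta^*})=s_{\beta^*}$; in particular $L_R(G)\cong MM^*$. -/

import Mathlib

universe u v w x a b

/-- A directed graph with vertex set `V`, edge set `E`, range map `r` and source map `s`
(loops and multiple edges are allowed). -/
structure DirectedGraph (V : Type u) (E : Type v) where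
  r : E → V
  s : E → V

namespace DirectedGraph

variable {V : Type u} {E : Type v} (Γ : DirectedGraph V E)

/-- A singular vertex: a source (it receives no edge) or an infinite receiver. -/
def IsSingular (p : V) : Prop :=
  {e | Γ.r e = p} = ∅ ∨ {e | Γ.r e = p}.Infinite

/-- `μ₁ μ₂ … μₙ` is a sequence of composable edges: `s(μᵢ) = r(μᵢ₊₁)`. -/
def IsChain (μ : List E) : Prop :=
  List.IsChain (fun e f => Γ.s e = Γ.r f) μ

/-- A finite path: a finite composable sequence of edges together with its range vertex, so that
the paths of length `0` are exactly the vertices. -/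
structure FinPath where
  range : V
  edges : List E
  isChain : Γ.IsChain edges
  range_eq : ∀ e ∈ edges.head?, Γ.r e = range

/-- The source of a finite path: the source of its last edge, or the vertex itself when the path
has length `0`. -/
def FinPath.source {Γ : DirectedGraph V E} (μ : Γ.FinPath) : V :=
  μ.edges.getLast?.elim μ.range Γ.s

/-- A cycle: a finite path of length at least one with `s(α) = r(α)` and with
`s(αᵢ) ≠ s(αⱼ)` for `i ≠ j`. -/
def IsCycle (α : List E) : Prop :=
  Γ.IsChain α ∧ (∃ h : α ≠ [], Γ.s (α.getLast h) = Γ.r (α.head h)) ∧ (α.map Γ.s).Nodup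

/-- No cycle of the graph has all its edges in the set `F`. -/
def AcyclicOn (F : Set E) : Prop :=
  ∀ α : List E, Γ.IsCycle α → ¬ ∀ e ∈ α, e ∈ F

/-- An infinite path `x 0, x 1, x 2, …`; its range is `r (x 0)`. -/
def IsInfPath (x : ℕ → E) : Prop :=
  ∀ i, Γ.s (x i) = Γ.r (x (i + 1))

/-- A head: an acyclic infinite path such that each `r(xᵢ)` receives only `xᵢ` and
each `s(xᵢ)` emits only `xᵢ`. -/
def IsHead (x : ℕ → E) : Prop :=
  Γ.IsInfPath x ∧ Γ.AcyclicOn (Set.range x) ∧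
    (∀ i e, Γ.r e = Γ.r (x i) → e = x i) ∧ (∀ i e, Γ.s e = Γ.s (x i) → e = x i)

/-- The edges of the subgraph `T` with vertex set `T⁰ = V ∖ G₀`: those with both ends in `T⁰`. -/
def complEdges (G₀ : Set V) : Set E :=
  {e | Γ.s e ∉ G₀ ∧ Γ.r e ∉ G₀}

/-- An infinite path in the subgraph `T` complementary to `G₀`. -/
def IsComplInfPath (G₀ : Set V) (y : ℕ → E) : Prop :=
  Γ.IsInfPath y ∧ ∀ i, y i ∈ Γ.complEdges G₀

/-- Each vertex in `G₀` is the range of at most one infinite path all of whose edges have their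
source outside `G₀`. -/
def CondT1 (G₀ : Set V) : Prop :=
  ∀ p ∈ G₀, ∀ x y : ℕ → E,
    Γ.IsInfPath x → Γ.r (x 0) = p → (∀ i, Γ.s (x i) ∉ G₀) →
    Γ.IsInfPath y → Γ.r (y 0) = p → (∀ i, Γ.s (y i) ∉ G₀) → x = y

/-- For each infinite path `y` in `T` there is a path from `r(y)` to a vertex in `G₀`. -/
def CondT2 (G₀ : Set V) : Prop :=
  ∀ y, Γ.IsComplInfPath G₀ y → ∃ μ : Γ.FinPath, μ.source = Γ.r (y 0) ∧ μ.range ∈ G₀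

/-- For each infinite path `y` in `T`, every `r(yᵢ)` emits exactly one edge. -/
def CondT3 (G₀ : Set V) : Prop :=
  ∀ y, Γ.IsComplInfPath G₀ y → ∀ i, ∃! e, Γ.s e = Γ.r (y i)

/-- For each infinite path `y` in `T`, each edge with source `r(y)` has as range a vertex that
receives only finitely many edges. -/
def CondT4 (G₀ : Set V) : Prop :=
  ∀ y, Γ.IsComplInfPath G₀ y → ∀ e, Γ.s e = Γ.r (y 0) → {f | Γ.r f = Γ.r e}.Finite

/-- The edges of the contracted graph: the finite paths `β` of length at least one with
`s(β), r(β) ∈ G₀` and `s(βᵢ) ∉ G₀` for `1 ≤ i < |β|`. -/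
structure ContractedEdge (G₀ : Set V) where
  edges : List E
  ne_nil : edges ≠ []
  isChain : Γ.IsChain edges
  range_mem : Γ.r (edges.head ne_nil) ∈ G₀
  source_mem : Γ.s (edges.getLast ne_nil) ∈ G₀
  inner : ∀ e ∈ edges.dropLast, Γ.s e ∉ G₀

/-- The graph with vertex set `G₀` and one edge for each path of `ContractedEdge`, with the same
range and source as that path. -/
def contract (G₀ : Set V) : DirectedGraph G₀ (Γ.ContractedEdge G₀) where
  r β := ⟨Γ.r (β.edges.head β.ne_nil), β.range_mem⟩
  s β := ⟨Γ.s (β.edges.getLast β.ne_nil), β.source_mem⟩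

/-- A contracted edge, regarded as a finite path of the original graph. -/
def ContractedEdge.toFinPath {Γ : DirectedGraph V E} {G₀ : Set V} (β : Γ.ContractedEdge G₀) :
    Γ.FinPath where
  range := Γ.r (β.edges.head β.ne_nil)
  edges := β.edges
  isChain := β.isChain
  range_eq := by
    intro e he
    rw [List.head?_eq_some_head β.ne_nil] at he
    rw [Option.mem_some.mp he]

/-- A Leavitt family of the graph in a (not necessarily unital) ring `A`: `P p` and `S e` are
the images of vertices and edges, and `S' e` is the image of the ghost edge `e*`. -/
structure IsLeavittFamily {A : Type w} [NonUnitalRing A]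
    (P : V → A) (S S' : E → A) : Prop where
  idem : ∀ p, P p * P p = P p
  orth : ∀ p q, p ≠ q → P p * P q = 0
  r_edge : ∀ e, P (Γ.r e) * S e = S e
  edge_s : ∀ e, S e * P (Γ.s e) = S e
  s_ghost : ∀ e, P (Γ.s e) * S' e = S' e
  ghost_r : ∀ e, S' e * P (Γ.r e) = S' e
  ghost_edge : ∀ e, S' e * S e = P (Γ.s e)
  ghost_edge_ne : ∀ e f, e ≠ f → S' e * S f = 0
  sum_eq : ∀ p, ¬ Γ.IsSingular p → ∀ h : {e | Γ.r e = p}.Finite,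
    P p = ∑ e ∈ h.toFinset, S e * S' e

end DirectedGraph

/-- Generators of the Leavitt path algebra: vertices, edges and ghost edges. -/
inductive LeavittGen (V : Type u) (E : Type v) : Type (max u v)
  | vert : V → LeavittGen V E
  | edge : E → LeavittGen V E
  | ghost : E → LeavittGen V E

namespace Leavitt

variable (R : Type w) [CommRing R] {V : Type u} {E : Type v} (Γ : DirectedGraph V E)

open LeavittGen in
/-- The Leavitt relations, imposed on the free unital algebra on the generators. -/
inductive Rel : FreeAlgebra R (LeavittGen V E) → FreeAlgebra R (LeavittGen V E) → Prop
  | idem (p : V) : Rel (.ι R (vert p) * .ι R (vert p)) (.ι R (vert p))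
  | orth (p q : V) : p ≠ q → Rel (.ι R (vert p) * .ι R (vert q)) 0
  | r_edge (e : E) : Rel (.ι R (vert (Γ.r e)) * .ι R (edge e)) (.ι R (edge e))
  | edge_s (e : E) : Rel (.ι R (edge e) * .ι R (vert (Γ.s e))) (.ι R (edge e))
  | s_ghost (e : E) : Rel (.ι R (vert (Γ.s e)) * .ι R (ghost e)) (.ι R (ghost e))
  | ghost_r (e : E) : Rel (.ι R (ghost e) * .ι R (vert (Γ.r e))) (.ι R (ghost e))
  | ghost_edge (e : E) : Rel (.ι R (ghost e) * .ι R (edge e)) (.ι R (vert (Γ.s e)))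
  | ghost_edge_ne (e f : E) : e ≠ f → Rel (.ι R (ghost e) * .ι R (edge f)) 0
  | sum_eq (p : V) (h : {e | Γ.r e = p}.Finite) : ¬ Γ.IsSingular p →
      Rel (.ι R (vert p)) (∑ e ∈ h.toFinset, .ι R (edge e) * .ι R (ghost e))

/-- The unital algebra presented by the Leavitt generators and relations. -/
abbrev UnitalAlg : Type (max u v w) := RingQuot (Rel R Γ)

/-- The class of a generator in the unital algebra. -/
noncomputable def gen (g : LeavittGen V E) : UnitalAlg R Γ :=
  RingQuot.mkAlgHom R (Rel R Γ) (FreeAlgebra.ι R g)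

end Leavitt

/-- The Leavitt path algebra `L_R(Γ)`, as a not necessarily unital `R`-algebra: the non-unital
subalgebra generated by the vertices, edges and ghost edges inside the unital algebra with the same
presentation.  Its universal property among all (not necessarily unital) `R`-algebras is proved in
`LeavittPathAlgebra.existsUnique_lift`. -/
abbrev LeavittPathAlgebra (R : Type w) [CommRing R] {V : Type u} {E : Type v}
    (Γ : DirectedGraph V E) : Type (max u v w) :=
  NonUnitalAlgebra.adjoin R (Set.range (Leavitt.gen R Γ))

namespace LeavittPathAlgebra

variable (R : Type w) [CommRing R] {V : Type u} {E : Type v} (Γ : DirectedGraph V E)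

/-- The generator `p_v` of the Leavitt path algebra. -/
noncomputable def vert (p : V) : LeavittPathAlgebra R Γ :=
  ⟨Leavitt.gen R Γ (.vert p), NonUnitalAlgebra.subset_adjoin R ⟨_, rfl⟩⟩

/-- The generator `s_e` of the Leavitt path algebra. -/
noncomputable def edge (e : E) : LeavittPathAlgebra R Γ :=
  ⟨Leavitt.gen R Γ (.edge e), NonUnitalAlgebra.subset_adjoin R ⟨_, rfl⟩⟩

/-- The generator `s_{e*}` of the Leavitt path algebra. -/
noncomputable def ghost (e : E) : LeavittPathAlgebra R Γ :=
  ⟨Leavitt.gen R Γ (.ghost e), NonUnitalAlgebra.subset_adjoin R ⟨_, rfl⟩⟩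

theorem isLeavittFamily :
    Γ.IsLeavittFamily (vert R Γ) (edge R Γ) (ghost R Γ) := by
  constructor
  · intro p
    apply Subtype.ext
    simpa [vert, Leavitt.gen] using RingQuot.mkAlgHom_rel R (Leavitt.Rel.idem (R := R) (Γ := Γ) p)
  · intro p q h
    apply Subtype.ext
    simpa [vert, Leavitt.gen] using
      RingQuot.mkAlgHom_rel R (Leavitt.Rel.orth (R := R) (Γ := Γ) p q h)
  · intro e
    apply Subtype.ext
    simpa [vert, edge, Leavitt.gen] using
      RingQuot.mkAlgHom_rel R (Leavitt.Rel.r_edge (R := R) (Γ := Γ) e)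
  · intro e
    apply Subtype.ext
    simpa [vert, edge, Leavitt.gen] using
      RingQuot.mkAlgHom_rel R (Leavitt.Rel.edge_s (R := R) (Γ := Γ) e)
  · intro e
    apply Subtype.ext
    simpa [vert, ghost, Leavitt.gen] using
      RingQuot.mkAlgHom_rel R (Leavitt.Rel.s_ghost (R := R) (Γ := Γ) e)
  · intro e
    apply Subtype.ext
    simpa [vert, ghost, Leavitt.gen] using
      RingQuot.mkAlgHom_rel R (Leavitt.Rel.ghost_r (R := R) (Γ := Γ) e)
  · intro e
    apply Subtype.ext
    simpa [vert, edge, ghost, Leavitt.gen] using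
      RingQuot.mkAlgHom_rel R (Leavitt.Rel.ghost_edge (R := R) (Γ := Γ) e)
  · intro e f h
    apply Subtype.ext
    simpa [edge, ghost, Leavitt.gen] using
      RingQuot.mkAlgHom_rel R (Leavitt.Rel.ghost_edge_ne (R := R) (Γ := Γ) e f h)
  · intro p hp h
    apply Subtype.ext
    simpa [vert, edge, ghost, Leavitt.gen] using
      RingQuot.mkAlgHom_rel R (Leavitt.Rel.sum_eq (R := R) (Γ := Γ) p h hp)

/-- The universal property of the Leavitt path algebra. -/
theorem existsUnique_lift {A : Type x} [NonUnitalRing A] [Module R A] [IsScalarTower R A A]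
    [SMulCommClass R A A] {P : V → A} {S S' : E → A} (hf : Γ.IsLeavittFamily P S S') :
    ∃! π : LeavittPathAlgebra R Γ →ₙₐ[R] A,
      (∀ p, π (vert R Γ p) = P p) ∧ (∀ e, π (edge R Γ e) = S e) ∧
        (∀ e, π (ghost R Γ e) = S' e) := by
  let val : LeavittGen V E → A := fun g =>
    match g with
    | .vert p => P p
    | .edge e => S e
    | .ghost e => S' e
  let F : FreeAlgebra R (LeavittGen V E) →ₐ[R] Unitization R A :=
    FreeAlgebra.lift R fun g => ((val g : A) : Unitization R A)
  have hF : ∀ g, F (FreeAlgebra.ι R g) = ((val g : A) : Unitization R A) := fun g =>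
    FreeAlgebra.lift_ι_apply _ _
  have hrel : ∀ ⦃y z⦄, Leavitt.Rel R Γ y z → F y = F z := by
    intro y z h
    induction h with
    | idem p => simp only [map_mul, hF, ← Unitization.inr_mul]; rw [hf.idem]
    | orth p q h =>
      simp only [map_mul, map_zero, hF, ← Unitization.inr_mul]; rw [hf.orth p q h]; simp
    | r_edge e => simp only [map_mul, hF, ← Unitization.inr_mul]; rw [hf.r_edge]
    | edge_s e => simp only [map_mul, hF, ← Unitization.inr_mul]; rw [hf.edge_s]
    | s_ghost e => simp only [map_mul, hF, ← Unitization.inr_mul]; rw [hf.s_ghost]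
    | ghost_r e => simp only [map_mul, hF, ← Unitization.inr_mul]; rw [hf.ghost_r]
    | ghost_edge e => simp only [map_mul, hF, ← Unitization.inr_mul]; rw [hf.ghost_edge]
    | ghost_edge_ne e f h =>
      simp only [map_mul, map_zero, hF, ← Unitization.inr_mul]
      rw [hf.ghost_edge_ne e f h]; simp
    | sum_eq p h hp =>
      simp only [map_mul, map_sum, hF, ← Unitization.inr_mul]
      change ((P p : A) : Unitization R A) = _
      rw [hf.sum_eq p hp h]
      exact map_sum (Unitization.inrNonUnitalAlgHom R A) _ _
  let Φ : Leavitt.UnitalAlg R Γ →ₐ[R] Unitization R A := RingQuot.liftAlgHom R ⟨F, hrel⟩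
  have hΦ : ∀ g, Φ (Leavitt.gen R Γ g) = ((val g : A) : Unitization R A) := fun g => by
    simp only [Φ, Leavitt.gen, RingQuot.liftAlgHom_mkAlgHom_apply, hF]
  have hfst : ∀ z : LeavittPathAlgebra R Γ, (Φ (z : Leavitt.UnitalAlg R Γ)).fst = 0 := by
    rintro ⟨z, hz⟩
    change (Φ z).fst = 0
    induction hz using NonUnitalAlgebra.adjoin_induction with
    | mem z hz => obtain ⟨g, rfl⟩ := hz; rw [hΦ]; rfl
    | add y z _ _ hy hz => simp [hy, hz]
    | zero => simp
    | mul y z _ _ hy hz => simp [hy]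
    | smul c z _ hz => simp [hz]
  let π : LeavittPathAlgebra R Γ →ₙₐ[R] A :=
    { toFun := fun z => (Φ (z : Leavitt.UnitalAlg R Γ)).snd
      map_smul' := fun c z => by simp
      map_zero' := by simp
      map_add' := fun y z => by simp
      map_mul' := fun y z => by simp [hfst] }
  refine ⟨π, ⟨fun p => ?_, fun e => ?_, fun e => ?_⟩, ?_⟩
  · exact congrArg (fun z : Unitization R A => z.snd) (hΦ (.vert p))
  · exact congrArg (fun z : Unitization R A => z.snd) (hΦ (.edge e))
  · exact congrArg (fun z : Unitization R A => z.snd) (hΦ (.ghost e))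
  · rintro π' ⟨h1, h2, h3⟩
    ext ⟨z, hz⟩
    induction hz using NonUnitalAlgebra.adjoin_induction with
    | mem z hz =>
      obtain ⟨g, rfl⟩ := hz
      refine Eq.trans ?_ (congrArg (fun z : Unitization R A => z.snd) (hΦ g)).symm
      cases g with
      | vert p => exact h1 p
      | edge e => exact h2 e
      | ghost e => exact h3 e
    | add y z hy hz ihy ihz =>
      exact (map_add π' ⟨y, hy⟩ ⟨z, hz⟩).trans
        ((congrArg₂ (· + ·) ihy ihz).trans (map_add π ⟨y, hy⟩ ⟨z, hz⟩).symm)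
    | zero => exact (map_zero π').trans (map_zero π).symm
    | mul y z hy hz ihy ihz =>
      exact (map_mul π' ⟨y, hy⟩ ⟨z, hz⟩).trans
        ((congrArg₂ (· * ·) ihy ihz).trans (map_mul π ⟨y, hy⟩ ⟨z, hz⟩).symm)
    | smul c z hz ih =>
      exact (map_smul π' c ⟨z, hz⟩).trans
        ((congrArg (c • ·) ih).trans (map_smul π c ⟨z, hz⟩).symm)

/-- The element `s_μ` for the finite path with range `p` and list of edges `μ`:
`p_p` for a path of length `0`, and `s_{μ₁} ⋯ s_{μₙ}` (times the redundant factor `p_{s(μₙ)}`)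
for `μ = μ₁ … μₙ`. -/
noncomputable def pathAux : V → List E → LeavittPathAlgebra R Γ
  | p, [] => vert R Γ p
  | _, e :: μ => edge R Γ e * pathAux (Γ.s e) μ

/-- The element `s_{μ*}` for the finite path with range `p` and list of edges `μ`:
`p_p` for a path of length `0`, and `s_{μₙ*} ⋯ s_{μ₁*}` (with the redundant factor `p_{s(μₙ)}`
in front) for `μ = μ₁ … μₙ`. -/
noncomputable def ghostPathAux : V → List E → LeavittPathAlgebra R Γ
  | p, [] => vert R Γ p
  | _, e :: μ => ghostPathAux (Γ.s e) μ * ghost R Γ e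

variable {Γ}

/-- The element `s_μ` of the Leavitt path algebra. -/
noncomputable def path (μ : Γ.FinPath) : LeavittPathAlgebra R Γ :=
  pathAux R Γ μ.range μ.edges

/-- The element `s_{μ*}` of the Leavitt path algebra. -/
noncomputable def ghostPath (μ : Γ.FinPath) : LeavittPathAlgebra R Γ :=
  ghostPathAux R Γ μ.range μ.edges

variable (Γ)

/-- `M`, the `R`-span of the elements `s_μ s_{ν*}` with `r(μ) ∈ G₀`. -/
noncomputable def spanM (G₀ : Set V) : Submodule R (LeavittPathAlgebra R Γ) :=
  Submodule.span R {z | ∃ μ ν : Γ.FinPath, μ.range ∈ G₀ ∧ z = path R μ * ghostPath R ν}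

/-- `M*`, the `R`-span of the elements `s_μ s_{ν*}` with `r(ν) ∈ G₀`. -/
noncomputable def spanMStar (G₀ : Set V) : Submodule R (LeavittPathAlgebra R Γ) :=
  Submodule.span R {z | ∃ μ ν : Γ.FinPath, ν.range ∈ G₀ ∧ z = path R μ * ghostPath R ν}

variable {Γ}

/-- The product of two submodules of the Leavitt path algebra: the span of all products. -/
noncomputable def mulSpan (M N : Submodule R (LeavittPathAlgebra R Γ)) :
    Submodule R (LeavittPathAlgebra R Γ) :=
  Submodule.map₂ (LinearMap.mul R (LeavittPathAlgebra R Γ)) M N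

end LeavittPathAlgebra

/-- A surjective Morita context `(A, B, M, N, ψ, φ)` between (not necessarily unital) `R`-algebras:
`M` is an `A`-`B`-bimodule, `N` is a `B`-`A`-bimodule (with unital actions, `A M = M = M B` and
`B N = N = N A`), and `ψ : M ⊗_B N → A`, `φ : N ⊗_A M → B` are surjective bimodule homomorphisms
satisfying `ψ(m ⊗ n) m' = m φ(n ⊗ m')` and `φ(n ⊗ m) n' = n ψ(m ⊗ n')`.  Homomorphisms out of the
balanced tensor products are given as balanced bilinear maps; surjectivity then says that the
values of the bilinear map span. -/
structure SurjectiveMoritaContext (R : Type w) [CommRing R]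
    (A : Type a) [NonUnitalRing A] [Module R A] (B : Type b) [NonUnitalRing B] [Module R B]
    (M : Type u) [AddCommGroup M] [Module R M] (N : Type v) [AddCommGroup N] [Module R N] where
  /-- The left action of `A` on `M`. -/
  lM : A →ₗ[R] M →ₗ[R] M
  /-- The right action of `B` on `M`. -/
  rM : M →ₗ[R] B →ₗ[R] M
  /-- The left action of `B` on `N`. -/
  lN : B →ₗ[R] N →ₗ[R] N
  /-- The right action of `A` on `N`. -/
  rN : N →ₗ[R] A →ₗ[R] N
  lM_mul : ∀ c d m, lM (c * d) m = lM c (lM d m)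
  rM_mul : ∀ m c d, rM m (c * d) = rM (rM m c) d
  lM_rM : ∀ c m d, lM c (rM m d) = rM (lM c m) d
  lN_mul : ∀ c d n, lN (c * d) n = lN c (lN d n)
  rN_mul : ∀ n c d, rN n (c * d) = rN (rN n c) d
  lN_rN : ∀ c n d, lN c (rN n d) = rN (lN c n) d
  lM_unital : Submodule.span R {z | ∃ c m, lM c m = z} = ⊤
  rM_unital : Submodule.span R {z | ∃ m c, rM m c = z} = ⊤
  lN_unital : Submodule.span R {z | ∃ c n, lN c n = z} = ⊤
  rN_unital : Submodule.span R {z | ∃ n c, rN n c = z} = ⊤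
  /-- The pairing `M ⊗_B N → A`. -/
  ψ : M →ₗ[R] N →ₗ[R] A
  /-- The pairing `N ⊗_A M → B`. -/
  φ : N →ₗ[R] M →ₗ[R] B
  ψ_balanced : ∀ m c n, ψ (rM m c) n = ψ m (lN c n)
  φ_balanced : ∀ n c m, φ (rN n c) m = φ n (lM c m)
  ψ_left : ∀ c m n, ψ (lM c m) n = c * ψ m n
  ψ_right : ∀ m n c, ψ m (rN n c) = ψ m n * c
  φ_left : ∀ c n m, φ (lN c n) m = c * φ n m
  φ_right : ∀ n m c, φ n (rM m c) = φ n m * c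
  ψ_assoc : ∀ m n m', lM (ψ m n) m' = rM m (φ n m')
  φ_assoc : ∀ n m n', lN (φ n m) n' = rN n (ψ m n')
  ψ_surjective : Submodule.span R {z | ∃ m n, ψ m n = z} = ⊤
  φ_surjective : Submodule.span R {z | ∃ n m, φ n m = z} = ⊤

/-- Two (not necessarily unital) `R`-algebras are Morita equivalent if there is a surjective Morita
context between them. -/
def AreMoritaEquivalent (R : Type w) [CommRing R]
    (A : Type a) [NonUnitalRing A] [Module R A] (B : Type b) [NonUnitalRing B] [Module R B] :
    Prop :=
  ∃ (M : Type (max a b)) (_ : AddCommGroup M) (_ : Module R M)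
    (N : Type (max a b)) (_ : AddCommGroup N) (_ : Module R N),
    Nonempty (SurjectiveMoritaContext R A B M N)

/-!
The elements `p_v`, `s_β`, `s_{β*}` for `v ∈ G₀` and the paths `β` that return to `G₀` for the
first time form a Leavitt family of the contracted graph inside `L_R(E)`. The only relation that
is not formal is `p_v = ∑ s_β s_{β*}` at a vertex that is regular in the contracted graph. There,
an infinite path ending at `v` with all sources outside `G₀` would, in the absence of heads and by
`CondT3`, receive branches infinitely often, and by `CondT1` each branch extends to an edge of the
contracted graph, contradicting regularity (`DirectedGraph.regular_of_contract`). So no such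
infinite path exists, and the relation follows from those of `E` by König's lemma
(`LeavittPathAlgebra.vert_eq_sum_contract`).

Injectivity of the resulting `φ : L_R(G) → L_R(E)` comes from a form of the graded uniqueness
theorem for concrete representations (`LeavittPathAlgebra.IsBranching.injective`): a
representation on functions on a set `Z` is faithful if ghost edges act by composition with maps
of `Z` that raise a degree. Such a representation of `L_R(E)` exists on `V × ℕ × ℤ`, because
countably many copies of `ℕ` can be matched with one, and it restricts to one of `L_R(G)`, in
which `β` acts as the composite of its edges.

The range of `φ` is contained in the corner `M M*`, which is spanned by the `s_μ s_{ν*}` with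
`r(μ), r(ν) ∈ G₀` and `s(μ) = s(ν) = t`. Such an element lies in the range if `t ∈ G₀`, since then
`μ` and `ν` are products of first return paths, and by König's lemma if no infinite path with
sources outside `G₀` ends at `t`. In the remaining case `CondT2` and `CondT3` say that the edges
out of `t` form a single path to `G₀`. Along it one uses `s_g s_{g*} = p_{r(g)} - ∑ s_f s_{f*}`, a
finite sum by `CondT4` over edges `f` whose sources fall under the two other cases because of
`CondT1` (`LeavittPathAlgebra.cornerAt_of_reaches`).

Finally `M* M` is the ideal generated by `G₀`, which is everything by hereditariness, saturation
and `CondT2` (`LeavittPathAlgebra.mulSpan_spanMStar_spanM`), so `M` and `M*` form a surjective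
Morita context (`areMoritaEquivalent_of_idempotents`).
-/

/-! ### Finite paths as lists of edges -/

namespace DirectedGraph

variable {V : Type u} {E : Type v} (Γ : DirectedGraph V E)

/-- `Γ.IsPath p l q`: the edges in the list `l` form a finite path with range `p` and source `q`.
This is the inductive counterpart of `FinPath`; the empty list is a path from each vertex to
itself. -/
inductive IsPath : V → List E → V → Prop
  | nil (p : V) : IsPath p [] p
  | cons (e : E) {l : List E} {q : V} : IsPath (Γ.s e) l q → IsPath (Γ.r e) (e :: l) q

variable {Γ}

theorem IsPath.append {p q t : V} {l m : List E} (h : Γ.IsPath p l q) (h' : Γ.IsPath q m t) :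
    Γ.IsPath p (l ++ m) t := by
  induction h with
  | nil => exact h'
  | cons e _ ih => exact .cons e (ih h')

theorem IsPath.concat {p q : V} {l : List E} (h : Γ.IsPath p l q) {e : E} (he : Γ.r e = q) :
    Γ.IsPath p (l ++ [e]) (Γ.s e) := by
  subst he
  exact h.append (.cons e (.nil _))

theorem IsPath.eq_of_nil {p q : V} (h : Γ.IsPath p [] q) : p = q := by
  cases h
  rfl

theorem IsPath.exists_concat {p q : V} {l : List E} (h : Γ.IsPath p l q) (hl : l ≠ []) :
    ∃ m e, l = m ++ [e] ∧ Γ.s e = q ∧ Γ.IsPath p m (Γ.r e) := by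
  induction h with
  | nil => exact absurd rfl hl
  | @cons e l q h ih =>
    by_cases hl0 : l = []
    · subst hl0
      exact ⟨[], e, rfl, h.eq_of_nil, .nil _⟩
    · obtain ⟨m, e', rfl, h1, h2⟩ := ih hl0
      exact ⟨e :: m, e', rfl, h1, .cons e h2⟩

theorem isPath_of_isChain {l : List E} {p : V} (h : Γ.IsChain l)
    (hp : ∀ e ∈ l.head?, Γ.r e = p) : Γ.IsPath p l (l.getLast?.elim p Γ.s) := by
  induction l generalizing p with
  | nil => exact .nil p
  | cons e l ih =>
    obtain rfl : Γ.r e = p := hp e rfl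
    have h' := List.isChain_cons.mp h
    have := ih (p := Γ.s e) h'.2 fun f hf => (h'.1 f hf).symm
    cases l with
    | nil => exact .cons e this
    | cons f l =>
      rw [List.getLast?_cons_cons]
      have hne : (f :: l).getLast? = some ((f :: l).getLast (by simp)) :=
        List.getLast?_eq_some_getLast (by simp)
      rw [hne] at this ⊢
      exact .cons e this

theorem FinPath.isPath (μ : Γ.FinPath) : Γ.IsPath μ.range μ.edges μ.source :=
  isPath_of_isChain μ.isChain μ.range_eq

theorem IsPath.head_range {p q : V} {l : List E} (h : Γ.IsPath p l q) :
    ∀ e ∈ l.head?, Γ.r e = p := by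
  cases h with
  | nil => simp
  | cons e h => simp

theorem IsPath.isChain {p q : V} {l : List E} (h : Γ.IsPath p l q) : Γ.IsChain l := by
  induction h with
  | nil => exact List.IsChain.nil
  | cons e h ih => exact List.isChain_cons.mpr ⟨fun f hf => (h.head_range f hf).symm, ih⟩

theorem IsPath.exists_finPath {p q : V} {l : List E} (h : Γ.IsPath p l q) :
    ∃ μ : Γ.FinPath, μ.range = p ∧ μ.edges = l :=
  ⟨⟨p, l, h.isChain, h.head_range⟩, rfl, rfl⟩

end DirectedGraph

namespace LeavittPathAlgebra

open DirectedGraph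

variable {R : Type w} [CommRing R] {V : Type u} {E : Type v} {Γ : DirectedGraph V E}

/-! ### Products of path elements -/

theorem vert_mul_vert (p : V) : vert R Γ p * vert R Γ p = vert R Γ p :=
  (isLeavittFamily R Γ).idem p

theorem vert_mul_vert_of_ne {p q : V} (h : p ≠ q) : vert R Γ p * vert R Γ q = 0 :=
  (isLeavittFamily R Γ).orth p q h

theorem vert_mul_edge (e : E) : vert R Γ (Γ.r e) * edge R Γ e = edge R Γ e :=
  (isLeavittFamily R Γ).r_edge e

theorem edge_mul_vert (e : E) : edge R Γ e * vert R Γ (Γ.s e) = edge R Γ e :=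
  (isLeavittFamily R Γ).edge_s e

theorem vert_mul_ghost (e : E) : vert R Γ (Γ.s e) * ghost R Γ e = ghost R Γ e :=
  (isLeavittFamily R Γ).s_ghost e

theorem ghost_mul_vert (e : E) : ghost R Γ e * vert R Γ (Γ.r e) = ghost R Γ e :=
  (isLeavittFamily R Γ).ghost_r e

theorem ghost_mul_edge (e : E) : ghost R Γ e * edge R Γ e = vert R Γ (Γ.s e) :=
  (isLeavittFamily R Γ).ghost_edge e

theorem ghost_mul_edge_of_ne {e f : E} (h : e ≠ f) : ghost R Γ e * edge R Γ f = 0 :=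
  (isLeavittFamily R Γ).ghost_edge_ne e f h

theorem edge_mul_vert_of_ne {p : V} {e : E} (h : Γ.s e ≠ p) : edge R Γ e * vert R Γ p = 0 := by
  rw [← edge_mul_vert, mul_assoc, vert_mul_vert_of_ne h, mul_zero]

theorem ghost_mul_vert_of_ne {p : V} {e : E} (h : Γ.r e ≠ p) : ghost R Γ e * vert R Γ p = 0 := by
  rw [← ghost_mul_vert, mul_assoc, vert_mul_vert_of_ne h, mul_zero]

theorem vert_mul_pathAux {p q : V} {l : List E} (h : Γ.IsPath p l q) :
    vert R Γ p * pathAux R Γ p l = pathAux R Γ p l := by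
  cases h with
  | nil => exact vert_mul_vert p
  | cons e h => rw [pathAux, ← mul_assoc, vert_mul_edge]

theorem pathAux_mul_vert {p q : V} {l : List E} (h : Γ.IsPath p l q) :
    pathAux R Γ p l * vert R Γ q = pathAux R Γ p l := by
  induction h with
  | nil p => exact vert_mul_vert p
  | cons e h ih => rw [pathAux, mul_assoc, ih]

theorem ghostPathAux_mul_vert {p q : V} {l : List E} (h : Γ.IsPath p l q) :
    ghostPathAux R Γ p l * vert R Γ p = ghostPathAux R Γ p l := by
  cases h with
  | nil => exact vert_mul_vert p
  | cons e h => rw [ghostPathAux, mul_assoc, ghost_mul_vert]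

theorem vert_mul_ghostPathAux {p q : V} {l : List E} (h : Γ.IsPath p l q) :
    vert R Γ q * ghostPathAux R Γ p l = ghostPathAux R Γ p l := by
  induction h with
  | nil p => exact vert_mul_vert p
  | cons e h ih => rw [ghostPathAux, ← mul_assoc, ih]

/-- A common first edge cancels in `s_{μ*} s_ν`. -/
theorem ghostPathAux_cons_mul_pathAux_cons {p q t : V} {e : E} {l m : List E}
    (h : Γ.IsPath (Γ.s e) m t) :
    ghostPathAux R Γ p (e :: l) * pathAux R Γ q (e :: m) =
      ghostPathAux R Γ (Γ.s e) l * pathAux R Γ (Γ.s e) m := by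
  rw [ghostPathAux, pathAux, mul_assoc, ← mul_assoc (ghost R Γ e), ghost_mul_edge,
    vert_mul_pathAux h]

theorem ghostPathAux_cons_mul_pathAux_cons_of_ne {p q : V} {e f : E} {l m : List E}
    (h : e ≠ f) : ghostPathAux R Γ p (e :: l) * pathAux R Γ q (f :: m) = 0 := by
  rw [ghostPathAux, pathAux, mul_assoc, ← mul_assoc (ghost R Γ e), ghost_mul_edge_of_ne h,
    zero_mul, mul_zero]

theorem ghostPathAux_mul_pathAux {p q : V} {l : List E} (h : Γ.IsPath p l q) :
    ghostPathAux R Γ p l * pathAux R Γ p l = vert R Γ q := by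
  induction h with
  | nil p => exact vert_mul_vert p
  | cons e h ih => rw [ghostPathAux_cons_mul_pathAux_cons h, ih]

theorem pathAux_append {p q t : V} {l m : List E} (h : Γ.IsPath p l q) (h' : Γ.IsPath q m t) :
    pathAux R Γ p (l ++ m) = pathAux R Γ p l * pathAux R Γ q m := by
  induction h with
  | nil p => exact (vert_mul_pathAux h').symm
  | cons e h ih => rw [List.cons_append, pathAux, pathAux, ih h', mul_assoc]

theorem ghostPathAux_append {p q t : V} {l m : List E} (h : Γ.IsPath p l q)
    (h' : Γ.IsPath q m t) :
    ghostPathAux R Γ p (l ++ m) = ghostPathAux R Γ q m * ghostPathAux R Γ p l := by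
  induction h with
  | nil p => exact (ghostPathAux_mul_vert h').symm
  | cons e h ih => rw [List.cons_append, ghostPathAux, ghostPathAux, ih h', mul_assoc]

theorem pathAux_concat {p : V} {l : List E} {e : E} (h : Γ.IsPath p l (Γ.r e)) :
    pathAux R Γ p (l ++ [e]) = pathAux R Γ p l * edge R Γ e := by
  rw [pathAux_append h (.cons e (.nil _)), pathAux, pathAux, edge_mul_vert]

theorem ghostPathAux_concat {p : V} {l : List E} {e : E} (h : Γ.IsPath p l (Γ.r e)) :
    ghostPathAux R Γ p (l ++ [e]) = ghost R Γ e * ghostPathAux R Γ p l := by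
  rw [ghostPathAux_append h (.cons e (.nil _)), ghostPathAux, ghostPathAux, vert_mul_ghost]

/-! ### Spanning sets -/

/-- The Leavitt path algebra is generated by vertices, edges and ghost edges. -/
theorem mem_of_generators (S : NonUnitalSubalgebra R (LeavittPathAlgebra R Γ))
    (hv : ∀ p, vert R Γ p ∈ S) (he : ∀ e, edge R Γ e ∈ S) (hg : ∀ e, ghost R Γ e ∈ S)
    (z : LeavittPathAlgebra R Γ) : z ∈ S := by
  obtain ⟨z, hz⟩ := z
  induction hz using NonUnitalAlgebra.adjoin_induction with
  | mem z hz =>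
    obtain ⟨g, rfl⟩ := hz
    cases g with
    | vert p => exact hv p
    | edge e => exact he e
    | ghost e => exact hg e
  | add y z hy hz ihy ihz => exact add_mem ihy ihz
  | zero => exact zero_mem S
  | mul y z hy hz ihy ihz => exact mul_mem ihy ihz
  | smul c z hz ih => exact SMulMemClass.smul_mem c ih

variable (R Γ) in
/-- The elements `s_μ s_{ν*}` with `s(μ) = s(ν)` and `|μ| ≤ n`. -/
def monomials (n : ℕ∞) : Set (LeavittPathAlgebra R Γ) :=
  {z | ∃ p l q m t, Γ.IsPath p l t ∧ Γ.IsPath q m t ∧ (l.length : ℕ∞) ≤ n ∧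
    z = pathAux R Γ p l * ghostPathAux R Γ q m}

theorem vert_mul_mem_span_monomials {n : ℕ∞} (p : V) {z : LeavittPathAlgebra R Γ}
    (hz : z ∈ Submodule.span R (monomials R Γ n)) :
    vert R Γ p * z ∈ Submodule.span R (monomials R Γ n) := by
  induction hz using Submodule.span_induction with
  | mem z hz =>
    obtain ⟨q, l, q', m, t, h, h', hn, rfl⟩ := hz
    by_cases hp : p = q
    · subst hp
      rw [← mul_assoc, vert_mul_pathAux h]
      exact Submodule.subset_span ⟨_, _, _, _, _, h, h', hn, rfl⟩
    · rw [← vert_mul_pathAux h, ← mul_assoc, ← mul_assoc, vert_mul_vert_of_ne hp, zero_mul,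
        zero_mul]
      exact zero_mem _
  | zero => rw [mul_zero]; exact zero_mem _
  | add y z _ _ hy hz => rw [mul_add]; exact add_mem hy hz
  | smul c z _ hz => rw [mul_smul_comm]; exact Submodule.smul_mem _ _ hz

theorem edge_mul_mem_span_monomials (e : E) {z : LeavittPathAlgebra R Γ}
    (hz : z ∈ Submodule.span R (monomials R Γ ⊤)) :
    edge R Γ e * z ∈ Submodule.span R (monomials R Γ ⊤) := by
  induction hz using Submodule.span_induction with
  | mem z hz =>
    obtain ⟨q, l, q', m, t, h, h', -, rfl⟩ := hz
    by_cases hp : Γ.s e = q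
    · subst hp
      exact Submodule.subset_span
        ⟨_, e :: l, _, m, _, .cons e h, h', le_top, by rw [pathAux, mul_assoc]⟩
    · rw [← vert_mul_pathAux h, ← mul_assoc, ← mul_assoc, edge_mul_vert_of_ne hp, zero_mul,
        zero_mul]
      exact zero_mem _
  | zero => rw [mul_zero]; exact zero_mem _
  | add y z _ _ hy hz => rw [mul_add]; exact add_mem hy hz
  | smul c z _ hz => rw [mul_smul_comm]; exact Submodule.smul_mem _ _ hz

theorem ghost_mul_mem_span_monomials {n : ℕ∞} (e : E) {z : LeavittPathAlgebra R Γ}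
    (hz : z ∈ Submodule.span R (monomials R Γ (n + 1))) :
    ghost R Γ e * z ∈ Submodule.span R (monomials R Γ n) := by
  induction hz using Submodule.span_induction with
  | mem z hz =>
    obtain ⟨q, l, q', m, t, h, h', hn, rfl⟩ := hz
    cases h with
    | nil =>
      rw [pathAux, vert_mul_ghostPathAux h']
      rename' q => t
      by_cases hp : Γ.r e = t
      · subst hp
        refine Submodule.subset_span
          ⟨_, [], _, m ++ [e], _, .nil _, h'.concat rfl, by simp, ?_⟩
        rw [pathAux, ghostPathAux_concat h', ← mul_assoc, vert_mul_ghost]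
      · rw [← vert_mul_ghostPathAux h', ← mul_assoc, ghost_mul_vert_of_ne hp, zero_mul]
        exact zero_mem _
    | @cons f l _ h =>
      by_cases hef : e = f
      · subst hef
        refine Submodule.subset_span ⟨_, l, _, m, _, h, h', ?_, ?_⟩
        · have hn' : ((l.length : ℕ∞) + 1) ≤ n + 1 := by simpa using hn
          exact (ENat.add_le_add_iff_right (by simp)).mp hn'
        · rw [pathAux, ← mul_assoc, ← mul_assoc, ghost_mul_edge, vert_mul_pathAux h]
      · rw [pathAux, ← mul_assoc, ← mul_assoc, ghost_mul_edge_of_ne hef, zero_mul, zero_mul]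
        exact zero_mem _
  | zero => rw [mul_zero]; exact zero_mem _
  | add y z _ _ hy hz => rw [mul_add]; exact add_mem hy hz
  | smul c z _ hz => rw [mul_smul_comm]; exact Submodule.smul_mem _ _ hz

theorem span_monomials : Submodule.span R (monomials R Γ ⊤) = ⊤ := by
  set W := Submodule.span R (monomials R Γ ⊤)
  -- `W` is a left ideal, since it is stable under left multiplication by the generators
  have hleft : ∀ y z : LeavittPathAlgebra R Γ, z ∈ W → y * z ∈ W := by
    intro y
    refine mem_of_generators
      { carrier := {y | ∀ z ∈ W, y * z ∈ W}
        add_mem' := fun ha hb z hz => by rw [add_mul]; exact add_mem (ha z hz) (hb z hz)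
        zero_mem' := fun z _ => by rw [zero_mul]; exact zero_mem _
        mul_mem' := fun ha hb z hz => by rw [mul_assoc]; exact ha _ (hb z hz)
        smul_mem' := fun c a ha z hz => by
          rw [smul_mul_assoc]; exact Submodule.smul_mem _ _ (ha z hz) }
      (fun p z hz => vert_mul_mem_span_monomials p hz)
      (fun e z hz => edge_mul_mem_span_monomials e hz)
      (fun e z hz => ghost_mul_mem_span_monomials e (by simpa using hz)) y
  rw [Submodule.eq_top_iff']
  refine mem_of_generators
    { carrier := W
      add_mem' := add_mem
      zero_mem' := zero_mem _
      mul_mem' := fun {a b} _ hb => hleft a b hb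
      smul_mem' := fun c a ha => Submodule.smul_mem _ _ ha } ?_ ?_ ?_
  · exact fun p => Submodule.subset_span
      ⟨p, [], p, [], p, .nil p, .nil p, le_top, (vert_mul_vert p).symm⟩
  · refine fun e => Submodule.subset_span
      ⟨_, [e], _, [], _, .cons e (.nil _), .nil _, le_top, ?_⟩
    rw [pathAux, pathAux, ghostPathAux, edge_mul_vert, edge_mul_vert]
  · refine fun e => Submodule.subset_span
      ⟨_, [], _, [e], _, .nil _, .cons e (.nil _), le_top, ?_⟩
    rw [pathAux, ghostPathAux, ghostPathAux, vert_mul_ghost, vert_mul_ghost]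

/-- Every element is a finite sum of elements `p_v z`; so it vanishes if all the `p_v z` do. -/
theorem eq_zero_of_vert_mul {z : LeavittPathAlgebra R Γ} (h : ∀ p, vert R Γ p * z = 0) :
    z = 0 := by
  have hz : z ∈ ⨆ p, LinearMap.range (LinearMap.mulLeft R (vert R Γ p)) := by
    have : z ∈ Submodule.span R (monomials R Γ ⊤) := by rw [span_monomials]; trivial
    refine Submodule.span_le.mpr ?_ this
    rintro _ ⟨p, l, q, m, t, hl, hm, -, rfl⟩
    refine Submodule.mem_iSup_of_mem p ⟨pathAux R Γ p l * ghostPathAux R Γ q m, ?_⟩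
    rw [LinearMap.mulLeft_apply, ← mul_assoc, vert_mul_pathAux hl]
  obtain ⟨f, hf, rfl⟩ := (Submodule.mem_iSup_iff_exists_finsupp _ _).mp hz
  refine Finset.sum_eq_zero fun p hp => ?_
  have key : vert R Γ p * f.sum (fun _ y => y) = f p := by
    rw [Finsupp.sum, Finset.mul_sum, Finset.sum_eq_single p]
    · obtain ⟨y, hy⟩ := hf p
      rw [← hy, LinearMap.mulLeft_apply, ← mul_assoc, vert_mul_vert]
    · intro q _ hq
      obtain ⟨y, hy⟩ := hf q
      rw [← hy, LinearMap.mulLeft_apply, ← mul_assoc, vert_mul_vert_of_ne hq.symm, zero_mul]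
    · exact fun hp' => absurd hp hp'
  exact key.symm.trans (h p)

end LeavittPathAlgebra

namespace LeavittPathAlgebra

open DirectedGraph

variable {R : Type w} [CommRing R] {V : Type u} {E : Type v} {Γ : DirectedGraph V E}

/-! ### Faithfulness of branching representations -/

variable (R Γ) in
/-- The span of the elements `s_{ν*}` for the paths `ν` with source `p`. -/
def ghostSpan (p : V) : Submodule R (LeavittPathAlgebra R Γ) :=
  Submodule.span R (Set.range fun i : {i : V × List E // Γ.IsPath i.1 i.2 p} =>
    ghostPathAux R Γ i.1.1 i.1.2)

/-- An element of `p_p L` is a combination of ghost paths up to terms that begin with an edge. -/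
theorem vert_mul_mem_sup (p : V) (z : LeavittPathAlgebra R Γ) :
    vert R Γ p * z ∈ ghostSpan R Γ p ⊔
      ⨆ e : {e // Γ.r e = p}, LinearMap.range (LinearMap.mulLeft R (edge R Γ e)) := by
  have hz : z ∈ Submodule.span R (monomials R Γ ⊤) := by rw [span_monomials]; trivial
  induction hz using Submodule.span_induction with
  | mem z hz =>
    obtain ⟨q, l, q', m, t, h, h', -, rfl⟩ := hz
    by_cases hp : p = q
    · subst hp
      rw [← mul_assoc, vert_mul_pathAux h]
      cases h with
      | nil =>
        rw [pathAux, vert_mul_ghostPathAux h']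
        exact Submodule.mem_sup_left (Submodule.subset_span ⟨⟨(q', m), h'⟩, rfl⟩)
      | @cons e l _ h =>
        refine Submodule.mem_sup_right (Submodule.mem_iSup_of_mem ⟨e, rfl⟩
          ⟨pathAux R Γ (Γ.s e) l * ghostPathAux R Γ q' m, ?_⟩)
        rw [LinearMap.mulLeft_apply, pathAux, mul_assoc]
    · rw [← vert_mul_pathAux h, ← mul_assoc, ← mul_assoc, vert_mul_vert_of_ne hp, zero_mul,
        zero_mul]
      exact zero_mem _
  | zero => rw [mul_zero]; exact zero_mem _
  | add y z _ _ hy hz => rw [mul_add]; exact add_mem hy hz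
  | smul c z _ hz => rw [mul_smul_comm]; exact Submodule.smul_mem _ _ hz

/-- A representation of `L_R(Γ)` on the functions on a set `Z` in which vertices act as restriction
to subsets `D p` and ghost edges as composition with maps `D (s e) → D (r e)` that increase a
degree; values outside the sets `D p` and `D (s e)` are not constrained. The degree plays the role
of the `ℤ`-grading in the graded uniqueness theorem. -/
structure IsBranching {Z : Type x} (θ : LeavittPathAlgebra R Γ →ₙₐ[R] Module.End R (Z → R))
    (D : V → Set Z) (act : E → Z → Z) (deg : Z → ℤ) : Prop where
  nonempty : ∀ p, (D p).Nonempty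
  maps : ∀ e, ∀ z ∈ D (Γ.s e), act e z ∈ D (Γ.r e)
  deg_lt : ∀ e, ∀ z ∈ D (Γ.s e), deg z < deg (act e z)
  vert_apply : ∀ p g, ∀ z ∈ D p, θ (vert R Γ p) g z = g z
  ghost_apply : ∀ e g, ∀ z ∈ D (Γ.s e), θ (ghost R Γ e) g z = g (act e z)

namespace IsBranching

variable {Z : Type x} {θ : LeavittPathAlgebra R Γ →ₙₐ[R] Module.End R (Z → R)}
  {D : V → Set Z} {act : E → Z → Z} {deg : Z → ℤ} (hθ : IsBranching θ D act deg)

include hθ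

theorem edge_apply {e : E} {z : Z} (hz : z ∈ D (Γ.s e)) (g : Z → R) :
    θ (edge R Γ e) g (act e z) = g z := by
  rw [← hθ.ghost_apply e (θ (edge R Γ e) g) z hz, ← Module.End.mul_apply, ← map_mul,
    ghost_mul_edge,
    hθ.vert_apply _ _ z hz]

/-- The maps given by the edges are injective with disjoint ranges, because of the relations
`s_{e*} s_f = δ_{e,f} p_{s(e)}`. -/
theorem act_inj [Nontrivial R] {e f : E} {y z : Z} (hy : y ∈ D (Γ.s e)) (hz : z ∈ D (Γ.s f))
    (h : act e y = act f z) : e = f ∧ y = z := by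
  classical
  have hef : e = f := by
    by_contra hne
    have h1 : θ (ghost R Γ e * edge R Γ f) 1 y = 1 := by
      rw [map_mul, Module.End.mul_apply, hθ.ghost_apply e _ y hy, h, hθ.edge_apply hz]
      rfl
    rw [ghost_mul_edge_of_ne hne, map_zero] at h1
    exact zero_ne_one h1
  subst hef
  refine ⟨rfl, ?_⟩
  have h1 : θ (edge R Γ e) (Pi.single z 1) (act e y) = 1 := by
    rw [h, hθ.edge_apply hz, Pi.single_eq_same]
  rw [hθ.edge_apply hy] at h1
  by_contra hne
  rw [Pi.single_eq_of_ne hne] at h1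
  exact zero_ne_one h1

theorem foldr_mem {p q : V} {l : List E} (h : Γ.IsPath p l q) {z : Z} (hz : z ∈ D q) :
    l.foldr act z ∈ D p := by
  induction h with
  | nil => exact hz
  | cons e _ ih => exact hθ.maps e _ (ih hz)

theorem deg_le_foldr {p q : V} {l : List E} (h : Γ.IsPath p l q) {z : Z} (hz : z ∈ D q) :
    deg z ≤ deg (l.foldr act z) := by
  induction h with
  | nil => exact le_rfl
  | cons e h ih => exact (ih hz).trans (hθ.deg_lt e _ (hθ.foldr_mem h hz)).le

theorem deg_lt_foldr {p q : V} {e : E} {l : List E} (h : Γ.IsPath p (e :: l) q) {z : Z}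
    (hz : z ∈ D q) : deg z < deg ((e :: l).foldr act z) := by
  cases h with
  | cons e h => exact (hθ.deg_le_foldr h hz).trans_lt (hθ.deg_lt e _ (hθ.foldr_mem h hz))

theorem ghostPathAux_apply {p q : V} {l : List E} (h : Γ.IsPath p l q) (g : Z → R) {z : Z}
    (hz : z ∈ D q) : θ (ghostPathAux R Γ p l) g z = g (l.foldr act z) := by
  induction h generalizing g with
  | nil p => exact hθ.vert_apply p g z hz
  | cons e h ih =>
    rw [ghostPathAux, map_mul, Module.End.mul_apply, ih _ hz,
      hθ.ghost_apply e _ _ (hθ.foldr_mem h hz), List.foldr_cons]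

/-- Distinct paths with the same source move a point to distinct points. -/
theorem foldr_inj [Nontrivial R] {p p' q : V} {l l' : List E} (h : Γ.IsPath p l q)
    (h' : Γ.IsPath p' l' q) {z : Z} (hz : z ∈ D q) (heq : l.foldr act z = l'.foldr act z) :
    p = p' ∧ l = l' := by
  induction h generalizing p' l' with
  | nil p =>
    cases h' with
    | nil => exact ⟨rfl, rfl⟩
    | cons f h' => exact absurd (congrArg deg heq) (hθ.deg_lt_foldr (.cons f h') hz).ne
  | cons e h ih =>
    cases h' with
    | nil => exact absurd (congrArg deg heq) (hθ.deg_lt_foldr (.cons e h) hz).ne'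
    | cons f h' =>
      obtain ⟨rfl, h2⟩ := hθ.act_inj (hθ.foldr_mem h hz) (hθ.foldr_mem h' hz) heq
      exact ⟨rfl, by rw [(ih h' hz h2).2]⟩

/-- Combinations of ghost paths are determined by their values at a single point. -/
theorem eq_zero_of_mem_ghostSpan [Nontrivial R] {p : V} {y : LeavittPathAlgebra R Γ}
    (hy : y ∈ ghostSpan R Γ p) {z : Z} (hz : z ∈ D p) (h : ∀ g, θ y g z = 0) : y = 0 := by
  classical
  obtain ⟨c, rfl⟩ := (Finsupp.mem_span_range_iff_exists_finsupp).mp hy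
  suffices hc : c = 0 by rw [hc, Finsupp.sum_zero_index]
  ext ⟨i, hi⟩
  have := h (Pi.single (i.2.foldr act z) 1)
  rw [Finsupp.sum, map_sum, LinearMap.sum_apply, Finset.sum_apply,
    Finset.sum_eq_single ⟨i, hi⟩] at this
  · rwa [map_smul, LinearMap.smul_apply, Pi.smul_apply, hθ.ghostPathAux_apply hi _ hz,
      Pi.single_eq_same, smul_eq_mul, mul_one] at this
  · rintro ⟨j, hj⟩ - hne
    rw [map_smul, LinearMap.smul_apply, Pi.smul_apply, hθ.ghostPathAux_apply hj _ hz,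
      Pi.single_eq_of_ne, smul_zero]
    intro heq
    obtain ⟨h1, h2⟩ := hθ.foldr_inj hj hi hz heq
    exact hne (Subtype.ext (Prod.ext h1 h2))
  · intro hi'
    rw [Finsupp.notMem_support_iff.mp hi', zero_smul, map_zero]
    rfl

/-- An element of `p_p L` in the kernel vanishes as soon as all ghost edges annihilate it. -/
theorem eq_zero_of_ghost_mul [Nontrivial R] {p : V} {y : LeavittPathAlgebra R Γ}
    (hy : vert R Γ p * y = y) (hg : ∀ e, ghost R Γ e * y = 0) (h : θ y = 0) : y = 0 := by
  classical
  by_cases hp : Γ.IsSingular p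
  · have hmem := vert_mul_mem_sup p y
    rw [hy] at hmem
    obtain ⟨y₀, hy₀, y₁, hy₁, hsum⟩ := Submodule.mem_sup.mp hmem
    obtain ⟨f, hf, rfl⟩ := (Submodule.mem_iSup_iff_exists_finsupp _ _).mp hy₁
    -- an edge outside the support of `f` sees only the ghost part of `y`
    have hy₀0 : y₀ = 0 := by
      rcases hp with hp | hp
      · have : IsEmpty {e // Γ.r e = p} :=
          ⟨fun e => (Set.eq_empty_iff_forall_notMem.mp hp) e.1 e.2⟩
        have hf0 : f = 0 := Subsingleton.elim _ _
        rw [hf0, Finsupp.sum_zero_index, add_zero] at hsum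
        subst hsum
        obtain ⟨z, hz⟩ := hθ.nonempty p
        exact hθ.eq_zero_of_mem_ghostSpan hy₀ hz fun g => by rw [h]; rfl
      · obtain ⟨e, he, hef⟩ := hp.exists_notMem_finset (f.support.image Subtype.val)
        have hge : ghost R Γ e * y₀ = 0 := by
          have h1 := hg e
          rw [← hsum, mul_add, Finsupp.sum, Finset.mul_sum, Finset.sum_eq_zero, add_zero] at h1
          · exact h1
          · intro i hi
            obtain ⟨t, ht⟩ := hf i
            rw [← ht, LinearMap.mulLeft_apply, ← mul_assoc, ghost_mul_edge_of_ne, zero_mul]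
            rintro rfl
            exact hef (Finset.mem_image_of_mem _ hi)
        obtain ⟨z, hz⟩ := hθ.nonempty (Γ.s e)
        have he' : Γ.r e = p := he
        refine hθ.eq_zero_of_mem_ghostSpan hy₀ (he' ▸ hθ.maps e z hz) fun g => ?_
        rw [← hθ.ghost_apply e (θ y₀ g) z hz, ← Module.End.mul_apply, ← map_mul, hge, map_zero]
        rfl
    subst hy₀0
    rw [zero_add] at hsum
    subst hsum
    refine Finset.sum_eq_zero fun i hi => ?_
    obtain ⟨t, ht⟩ := hf i
    have h1 : ghost R Γ i.1 * f.sum (fun _ y => y) = ghost R Γ i.1 * f i := by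
      rw [Finsupp.sum, Finset.mul_sum, Finset.sum_eq_single i]
      · intro j _ hj
        obtain ⟨t', ht'⟩ := hf j
        rw [← ht', LinearMap.mulLeft_apply, ← mul_assoc, ghost_mul_edge_of_ne, zero_mul]
        exact fun hij => hj (Subtype.ext hij.symm)
      · exact fun hi' => absurd hi hi'
    rw [hg, ← ht, LinearMap.mulLeft_apply, ← mul_assoc, ghost_mul_edge] at h1
    rw [← ht, LinearMap.mulLeft_apply, ← edge_mul_vert, mul_assoc, ← h1, mul_zero]
  · have hfin : {e | Γ.r e = p}.Finite := by
      by_contra hinf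
      exact hp (Or.inr hinf)
    rw [← hy, (isLeavittFamily R Γ).sum_eq p hp hfin, Finset.sum_mul]
    exact Finset.sum_eq_zero fun e _ => by rw [mul_assoc, hg, mul_zero]

theorem eq_zero_of_mem_span_monomials [Nontrivial R] (n : ℕ) {y : LeavittPathAlgebra R Γ}
    (hy : y ∈ Submodule.span R (monomials R Γ n)) (h : θ y = 0) : y = 0 := by
  induction n generalizing y with
  | zero =>
    refine eq_zero_of_vert_mul fun p => ?_
    have hmem : vert R Γ p * y ∈ ghostSpan R Γ p := by
      clear h
      induction hy using Submodule.span_induction with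
      | mem z hz =>
        obtain ⟨q, l, q', m, t, hl, hm, hn, rfl⟩ := hz
        obtain rfl : l = [] := by simpa using hn
        obtain rfl := hl.eq_of_nil
        rw [pathAux, vert_mul_ghostPathAux hm]
        by_cases hp : p = q
        · subst hp
          rw [vert_mul_ghostPathAux hm]
          exact Submodule.subset_span ⟨⟨(q', m), hm⟩, rfl⟩
        · rw [← vert_mul_ghostPathAux hm, ← mul_assoc, vert_mul_vert_of_ne hp, zero_mul]
          exact zero_mem _
      | zero => rw [mul_zero]; exact zero_mem _
      | add y z _ _ hy hz => rw [mul_add]; exact add_mem hy hz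
      | smul c z _ hz => rw [mul_smul_comm]; exact Submodule.smul_mem _ _ hz
    obtain ⟨z, hz⟩ := hθ.nonempty p
    refine hθ.eq_zero_of_mem_ghostSpan hmem hz fun g => ?_
    rw [map_mul, h, mul_zero]
    rfl
  | succ n ih =>
    have hg : ∀ e, ghost R Γ e * y = 0 := fun e =>
      ih (ghost_mul_mem_span_monomials e (by exact_mod_cast hy)) (by rw [map_mul, h, mul_zero])
    refine eq_zero_of_vert_mul fun p =>
      hθ.eq_zero_of_ghost_mul (by rw [← mul_assoc, vert_mul_vert]) (fun e => ?_)
        (by rw [map_mul, h, mul_zero])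
    by_cases hp : Γ.r e = p
    · rw [← hp, ← mul_assoc, ghost_mul_vert, hg]
    · rw [← mul_assoc, ghost_mul_vert_of_ne hp, zero_mul]

/-- A branching representation is faithful. -/
theorem injective : Function.Injective θ := by
  cases subsingleton_or_nontrivial R
  · have := Module.subsingleton R (LeavittPathAlgebra R Γ)
    exact Function.injective_of_subsingleton _
  suffices hker : ∀ y, θ y = 0 → y = 0 by
    intro y z hyz
    have h : θ (y - z) + θ z = 0 + θ z := by
      rw [← map_add, zero_add, ← hyz]
      exact congrArg θ (sub_add_cancel y z)
    exact sub_eq_zero.mp (hker _ (add_right_cancel h))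
  intro y hy
  have hmem : y ∈ Submodule.span R (monomials R Γ ⊤) := by rw [span_monomials]; trivial
  have hex : ∃ n : ℕ, y ∈ Submodule.span R (monomials R Γ n) := by
    have hmono : ∀ {i j : ℕ}, i ≤ j → Submodule.span R (monomials R Γ i) ≤
        Submodule.span R (monomials R Γ j) := fun hij =>
      Submodule.span_mono fun z ⟨p, l, q, m, t, h, h', hn, hz⟩ =>
        ⟨p, l, q, m, t, h, h', hn.trans (by exact_mod_cast hij), hz⟩
    clear hy
    induction hmem using Submodule.span_induction with
    | mem z hz =>
      obtain ⟨p, l, q, m, t, h, h', -, hz⟩ := hz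
      exact ⟨l.length, Submodule.subset_span ⟨p, l, q, m, t, h, h', le_rfl, hz⟩⟩
    | zero => exact ⟨0, zero_mem _⟩
    | add y z _ _ hy hz =>
      obtain ⟨i, hi⟩ := hy
      obtain ⟨j, hj⟩ := hz
      exact ⟨max i j, add_mem (hmono (le_max_left i j) hi) (hmono (le_max_right i j) hj)⟩
    | smul c z _ hz =>
      obtain ⟨i, hi⟩ := hz
      exact ⟨i, Submodule.smul_mem _ _ hi⟩
  obtain ⟨n, hn⟩ := hex
  exact hθ.eq_zero_of_mem_span_monomials n hn hy

end IsBranching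

/-! ### A branching representation of a countable graph -/

/-- For a countable edge set, the copies of `ℕ` indexed by the edges into a vertex can be matched
with a single copy of `ℕ`, provided that there is at least one such edge. -/
theorem exists_nat_branching [Countable E] (Γ : DirectedGraph V E) :
    ∃ f : E → ℕ → ℕ,
      (∀ e e' n n', Γ.r e = Γ.r e' → f e n = f e' n' → e = e' ∧ n = n') ∧
      ∀ e m, ∃ e' n, Γ.r e' = Γ.r e ∧ f e' n = m := by
  classical
  have key : ∀ p : V, ∃ f : E → ℕ → ℕ,
      (∀ e e' n n', Γ.r e = p → Γ.r e' = p → f e n = f e' n' → e = e' ∧ n = n') ∧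
      ∀ e, Γ.r e = p → ∀ m, ∃ e' n, Γ.r e' = p ∧ f e' n = m := by
    intro p
    by_cases hp : Nonempty {e // Γ.r e = p}
    · obtain ⟨σ⟩ : Nonempty ({e // Γ.r e = p} × ℕ ≃ ℕ) := nonempty_equiv_of_countable
      refine ⟨fun e n => if h : Γ.r e = p then σ (⟨e, h⟩, n) else 0, ?_, ?_⟩
      · intro e e' n n' he he' h
        simp only [he, he', dif_pos] at h
        have := σ.injective h
        simpa using this
      · intro e he m
        refine ⟨(σ.symm m).1.1, (σ.symm m).2, (σ.symm m).1.2, ?_⟩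
        exact (dif_pos (σ.symm m).1.2).trans (σ.apply_symm_apply m)
    · exact ⟨fun _ _ => 0, fun e _ _ _ he => absurd ⟨e, he⟩ hp, fun e he => absurd ⟨e, he⟩ hp⟩
  choose f hf hf' using key
  refine ⟨fun e => f (Γ.r e) e, fun e e' n n' h heq => ?_, fun e m => ?_⟩
  · refine hf (Γ.r e) e e' n n' rfl h.symm ?_
    simp only at heq
    rw [← h] at heq
    exact heq
  · obtain ⟨e', n, h1, h2⟩ := hf' (Γ.r e) e rfl m
    refine ⟨e', n, h1, ?_⟩
    simp only [h1]
    exact h2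

/-- The Leavitt path algebra of a graph with countably many edges has a branching representation. -/
theorem exists_isBranching [Countable E] (R : Type w) [CommRing R] (Γ : DirectedGraph V E) :
    ∃ (θ : LeavittPathAlgebra R Γ →ₙₐ[R] Module.End R (V × ℕ × ℤ → R))
      (act : E → V × ℕ × ℤ → V × ℕ × ℤ),
      IsBranching θ (fun p => {z | z.1 = p}) act (fun z => z.2.2) := by
  classical
  obtain ⟨f, hf, hf'⟩ := exists_nat_branching Γ
  let act : E → V × ℕ × ℤ → V × ℕ × ℤ := fun e z => (Γ.r e, f e z.2.1, z.2.2 + 1)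
  have act_inj : ∀ e e' y z, y.1 = Γ.s e → z.1 = Γ.s e' → act e y = act e' z →
      e = e' ∧ y = z := by
    rintro e e' ⟨p, n, k⟩ ⟨p', n', k'⟩ hy hz h
    simp only [act, Prod.mk.injEq] at h
    obtain ⟨rfl, rfl⟩ := hf e e' n n' h.1 h.2.1
    refine ⟨rfl, ?_⟩
    simp only at hy hz
    rw [hy, hz, add_right_cancel h.2.2]
  have cover : ∀ e (z : V × ℕ × ℤ), z.1 = Γ.r e → ∃ e' y, y.1 = Γ.s e' ∧ act e' y = z := by
    rintro e ⟨p, m, k⟩ hz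
    obtain ⟨e', n, h1, h2⟩ := hf' e m
    refine ⟨e', (Γ.s e', n, k - 1), rfl, ?_⟩
    simp only at hz
    simp [act, h1, h2, hz]
  let P : V → Module.End R (V × ℕ × ℤ → R) := fun p =>
    { toFun := fun g z => if z.1 = p then g z else 0
      map_add' := fun g g' => by ext z; by_cases h : z.1 = p <;> simp [h]
      map_smul' := fun c g => by ext z; by_cases h : z.1 = p <;> simp [h] }
  let S' : E → Module.End R (V × ℕ × ℤ → R) := fun e =>
    { toFun := fun g z => if z.1 = Γ.s e then g (act e z) else 0
      map_add' := fun g g' => by ext z; by_cases h : z.1 = Γ.s e <;> simp [h]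
      map_smul' := fun c g => by ext z; by_cases h : z.1 = Γ.s e <;> simp [h] }
  let S : E → Module.End R (V × ℕ × ℤ → R) := fun e =>
    { toFun := fun g z => if h : ∃ y : V × ℕ × ℤ, y.1 = Γ.s e ∧ act e y = z
        then g h.choose else 0
      map_add' := fun g g' => by
        ext z; simp only [Pi.add_apply]; split_ifs <;> simp
      map_smul' := fun c g => by
        ext z; simp only [Pi.smul_apply, RingHom.id_apply]; split_ifs <;> simp }
  have hP : ∀ p g z, P p g z = if z.1 = p then g z else 0 := fun _ _ _ => rfl
  have hS' : ∀ e g z, S' e g z = if z.1 = Γ.s e then g (act e z) else 0 := fun _ _ _ => rfl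
  have hS : ∀ e g y, y.1 = Γ.s e → S e g (act e y) = g y := by
    intro e g y hy
    have h : ∃ y' : V × ℕ × ℤ, y'.1 = Γ.s e ∧ act e y' = act e y := ⟨y, hy, rfl⟩
    change (if h : ∃ y' : V × ℕ × ℤ, y'.1 = Γ.s e ∧ act e y' = act e y
        then g h.choose else 0) = _
    rw [dif_pos h, (act_inj _ _ _ _ h.choose_spec.1 hy h.choose_spec.2).2]
  have hS0 : ∀ e g z, (¬ ∃ y : V × ℕ × ℤ, y.1 = Γ.s e ∧ act e y = z) → S e g z = 0 :=
    fun e g z h => dif_neg h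
  have hact : ∀ e z, (act e z).1 = Γ.r e := fun _ _ => rfl
  have hfam : Γ.IsLeavittFamily P S S' := by
    refine ⟨fun p => ?_, fun p q hpq => ?_, fun e => ?_, fun e => ?_, fun e => ?_, fun e => ?_,
      fun e => ?_, fun e e' hne => ?_, fun p hp hfin => ?_⟩
    · ext g z; simp +contextual [hP, Module.End.mul_apply]
    · refine LinearMap.ext fun g => funext fun z => ?_
      rw [Module.End.mul_apply, hP, hP]
      split_ifs with h1 h2
      · exact absurd (h1.symm.trans h2) hpq
      all_goals rfl
    · refine LinearMap.ext fun g => funext fun z => ?_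
      rw [Module.End.mul_apply, hP]
      split_ifs with h1
      · rfl
      · refine (hS0 e g z ?_).symm
        rintro ⟨y, -, rfl⟩
        exact h1 rfl
    · refine LinearMap.ext fun g => funext fun z => ?_
      rw [Module.End.mul_apply]
      by_cases h : ∃ y : V × ℕ × ℤ, y.1 = Γ.s e ∧ act e y = z
      · obtain ⟨y, hy, rfl⟩ := h
        rw [hS e _ y hy, hS e _ y hy, hP, if_pos hy]
      · rw [hS0 _ _ _ h, hS0 _ _ _ h]
    · refine LinearMap.ext fun g => funext fun z => ?_
      rw [Module.End.mul_apply, hP, hS']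
      split_ifs <;> rfl
    · refine LinearMap.ext fun g => funext fun z => ?_
      rw [Module.End.mul_apply, hS', hS', hP, if_pos (hact e z)]
    · refine LinearMap.ext fun g => funext fun z => ?_
      rw [Module.End.mul_apply, hS', hP]
      split_ifs with h
      · exact hS e g z h
      · rfl
    · refine LinearMap.ext fun g => funext fun z => ?_
      rw [Module.End.mul_apply, hS']
      split_ifs with h
      · refine hS0 _ _ _ ?_
        rintro ⟨y, hy, hyz⟩
        exact hne (act_inj _ _ _ _ h hy hyz.symm).1
      · rfl
    · refine LinearMap.ext fun g => funext fun z => ?_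
      rw [LinearMap.sum_apply, Finset.sum_apply, hP]
      split_ifs with h
      · obtain ⟨e, he⟩ : {e | Γ.r e = p}.Nonempty :=
          Set.nonempty_iff_ne_empty.mpr fun h0 => hp (Or.inl h0)
        obtain ⟨e', y, hy, rfl⟩ := cover e z (h.trans he.symm)
        rw [Finset.sum_eq_single e']
        · rw [Module.End.mul_apply, hS _ _ _ hy, hS', if_pos hy]
        · intro e'' _ hne
          rw [Module.End.mul_apply]
          refine hS0 _ _ _ ?_
          rintro ⟨y', hy', heq⟩
          exact hne (act_inj _ _ _ _ hy' hy heq).1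
        · intro hne
          exact absurd (hfin.mem_toFinset.mpr h) hne
      · refine (Finset.sum_eq_zero fun e he => ?_).symm
        rw [Module.End.mul_apply]
        refine hS0 _ _ _ ?_
        rintro ⟨y, -, rfl⟩
        exact h (hfin.mem_toFinset.mp he)
  obtain ⟨θ, ⟨h1, -, h3⟩, -⟩ := existsUnique_lift R Γ hfam
  refine ⟨θ, act, fun p => ⟨(p, 0, 0), rfl⟩, fun e z _ => rfl, fun e z _ => ?_,
    fun p g z hz => ?_, fun e g z hz => ?_⟩
  · exact lt_add_one z.2.2
  · rw [h1, hP]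
    exact if_pos hz
  · rw [h3, hS']
    exact if_pos hz

end LeavittPathAlgebra

/-! ### Infinite paths with sources outside `G₀` -/

namespace DirectedGraph

variable {V : Type u} {E : Type v} {Γ : DirectedGraph V E} {G₀ : Set V}

variable (Γ G₀) in
/-- `x` is an infinite path with range `p` all of whose edges have their source outside `G₀`. -/
def Avoids (p : V) (x : ℕ → E) : Prop :=
  Γ.IsInfPath x ∧ Γ.r (x 0) = p ∧ ∀ i, Γ.s (x i) ∉ G₀

theorem Avoids.tail {p : V} {x : ℕ → E} (h : Γ.Avoids G₀ p x) :
    Γ.Avoids G₀ (Γ.s (x 0)) fun i => x (i + 1) :=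
  ⟨fun i => h.1 (i + 1), (h.1 0).symm, fun i => h.2.2 (i + 1)⟩

theorem Avoids.shift {p : V} {x : ℕ → E} (h : Γ.Avoids G₀ p x) (n : ℕ) :
    Γ.Avoids G₀ (Γ.r (x n)) fun i => x (i + n) :=
  ⟨fun i => by simpa [add_right_comm] using h.1 (i + n), by simp, fun i => h.2.2 (i + n)⟩

theorem Avoids.cons {e : E} {x : ℕ → E} (h : Γ.Avoids G₀ (Γ.s e) x) (he : Γ.s e ∉ G₀) :
    Γ.Avoids G₀ (Γ.r e) fun i => Nat.casesOn i e x := by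
  refine ⟨fun i => ?_, rfl, fun i => ?_⟩
  · cases i with
    | zero => exact h.2.1.symm
    | succ i => exact h.1 i
  · cases i with
    | zero => exact he
    | succ i => exact h.2.2 i

theorem Avoids.isComplInfPath {p : V} {x : ℕ → E} (h : Γ.Avoids G₀ p x) (hp : p ∉ G₀) :
    Γ.IsComplInfPath G₀ x := by
  refine ⟨h.1, fun i => ⟨h.2.2 i, ?_⟩⟩
  cases i with
  | zero => rwa [h.2.1]
  | succ i => rw [← h.1 i]; exact h.2.2 i

/-- A form of König's lemma: a property that passes from each vertex to the source outside `G₀` of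
some incoming edge propagates along an infinite path. -/
theorem exists_avoids {Q : V → Prop}
    (hQ : ∀ p, Q p → ∃ e, Γ.r e = p ∧ Γ.s e ∉ G₀ ∧ Q (Γ.s e)) {p : V} (hp : Q p) :
    ∃ x, Γ.Avoids G₀ p x := by
  choose f hf using fun t : {p // Q p} => hQ t.1 t.2
  let next : {p // Q p} → {p // Q p} := fun t => ⟨Γ.s (f t), (hf t).2.2⟩
  refine ⟨fun n => f (next^[n] ⟨p, hp⟩), fun i => ?_, (hf _).1, fun i => (hf _).2.1⟩
  simp only [Function.iterate_succ_apply']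
  exact (hf (next _)).1.symm

theorem exists_range_eq {p : V} (h : ¬ Γ.IsSingular p) : ∃ e, Γ.r e = p :=
  Set.nonempty_iff_ne_empty.mpr fun h0 => h (Or.inl h0)

theorem finite_of_not_isSingular {p : V} (h : ¬ Γ.IsSingular p) : {e | Γ.r e = p}.Finite := by
  by_contra hinf
  exact h (Or.inr hinf)

variable (Γ G₀) in
/-- There is a path from the given vertex (its source) to a vertex in `G₀` (its range). -/
inductive Reaches : V → Prop
  | base {p : V} : p ∈ G₀ → Reaches p
  | step (e : E) : Reaches (Γ.r e) → Reaches (Γ.s e)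

theorem IsPath.reaches {p q : V} {l : List E} (h : Γ.IsPath p l q) (hp : Γ.Reaches G₀ p) :
    Γ.Reaches G₀ q := by
  induction h with
  | nil => exact hp
  | cons e _ ih => exact ih (.step e hp)

theorem CondT2.reaches (hT2 : Γ.CondT2 G₀) {p : V} {x : ℕ → E} (hx : Γ.Avoids G₀ p x) :
    Γ.Reaches G₀ p := by
  by_cases hp : p ∈ G₀
  · exact .base hp
  · obtain ⟨μ, h1, h2⟩ := hT2 x (hx.isComplInfPath hp)
    rw [← hx.2.1, ← h1]
    exact μ.isPath.reaches (.base h2)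

/-- The uniqueness in `CondT1` extends to the vertices with a path to `G₀`. -/
theorem CondT1.eq_of_avoids (hT1 : Γ.CondT1 G₀) {p : V} (hp : Γ.Reaches G₀ p) {x y : ℕ → E}
    (hx : Γ.Avoids G₀ p x) (hy : Γ.Avoids G₀ p y) : x = y := by
  induction hp generalizing x y with
  | base hp => exact hT1 _ hp x y hx.1 hx.2.1 hx.2.2 hy.1 hy.2.1 hy.2.2
  | step e he ih =>
    by_cases hs : Γ.s e ∈ G₀
    · exact hT1 _ hs x y hx.1 hx.2.1 hx.2.2 hy.1 hy.2.1 hy.2.2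
    · have := ih (hx.cons hs) (hy.cons hs)
      exact funext fun i => congrFun this (i + 1)

/-- Off the unique infinite path there are no others. -/
theorem CondT1.not_avoids_of_ne (hT1 : Γ.CondT1 G₀) {x : ℕ → E} {f : E}
    (hx : Γ.Avoids G₀ (Γ.r f) x) (hp : Γ.Reaches G₀ (Γ.r f)) (hf : f ≠ x 0)
    (hs : Γ.s f ∉ G₀) (y : ℕ → E) : ¬ Γ.Avoids G₀ (Γ.s f) y := fun hy =>
  hf (congrFun (hT1.eq_of_avoids hp (hy.cons hs) hx) 0)

/-! ### The edges of the contracted graph -/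

variable (Γ G₀) in
/-- `l` is a path of length at least one with range `p` whose source lies in `G₀` and whose inner
vertices lie outside `G₀`. With `p ∈ G₀` these are the edges of the contracted graph. -/
inductive IsFirstReturn : V → List E → Prop
  | single (e : E) : Γ.s e ∈ G₀ → IsFirstReturn (Γ.r e) [e]
  | cons (e : E) {l : List E} : Γ.s e ∉ G₀ → IsFirstReturn (Γ.s e) l →
      IsFirstReturn (Γ.r e) (e :: l)

theorem IsFirstReturn.exists_isPath {p : V} {l : List E} (h : Γ.IsFirstReturn G₀ p l) :
    ∃ q ∈ G₀, Γ.IsPath p l q := by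
  induction h with
  | single e he => exact ⟨_, he, .cons e (.nil _)⟩
  | cons e _ _ ih =>
    obtain ⟨q, hq, h⟩ := ih
    exact ⟨q, hq, .cons e h⟩

theorem isFirstReturn_of_isPath {p q : V} {l : List E} (h : Γ.IsPath p l q) (hl : l ≠ [])
    (hq : q ∈ G₀) (hin : ∀ e ∈ l.dropLast, Γ.s e ∉ G₀) : Γ.IsFirstReturn G₀ p l := by
  induction h with
  | nil => exact absurd rfl hl
  | @cons e l q h ih =>
    cases l with
    | nil =>
      rw [← h.eq_of_nil] at hq
      exact .single e hq
    | cons f l =>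
      rw [List.dropLast_cons_cons] at hin
      exact .cons e (hin e (by simp)) (ih (by simp) hq fun g hg => hin g (by simp [hg]))

theorem IsFirstReturn.ne_nil {p : V} {l : List E} (h : Γ.IsFirstReturn G₀ p l) : l ≠ [] := by
  cases h <;> simp

theorem IsFirstReturn.inner {p : V} {l : List E} (h : Γ.IsFirstReturn G₀ p l) :
    ∀ e ∈ l.dropLast, Γ.s e ∉ G₀ := by
  induction h with
  | single => simp
  | cons e he h ih =>
    intro f hf
    rw [List.dropLast_cons_of_ne_nil h.ne_nil] at hf
    rcases List.mem_cons.mp hf with rfl | hf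
    · exact he
    · exact ih f hf

theorem IsFirstReturn.getLast_mem {p : V} {l : List E} (h : Γ.IsFirstReturn G₀ p l) :
    Γ.s (l.getLast h.ne_nil) ∈ G₀ := by
  induction h with
  | single e he => exact he
  | cons e he h ih =>
    rw [List.getLast_cons h.ne_nil]
    exact ih

theorem IsFirstReturn.range_head {p : V} {l : List E} (h : Γ.IsFirstReturn G₀ p l) :
    Γ.r (l.head h.ne_nil) = p := by
  cases h <;> rfl

theorem ContractedEdge.eq_of_edges_eq {β γ : Γ.ContractedEdge G₀} (h : β.edges = γ.edges) :
    β = γ := by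
  cases β
  cases γ
  simp only at h
  subst h
  rfl

theorem ContractedEdge.isPath (β : Γ.ContractedEdge G₀) :
    Γ.IsPath ((Γ.contract G₀).r β) β.edges ((Γ.contract G₀).s β) := by
  have h := β.toFinPath.isPath
  have hs : β.toFinPath.source = Γ.s (β.edges.getLast β.ne_nil) := by
    change β.edges.getLast?.elim _ _ = _
    rw [List.getLast?_eq_some_getLast β.ne_nil]
    rfl
  rw [hs] at h
  exact h

theorem ContractedEdge.isFirstReturn (β : Γ.ContractedEdge G₀) :
    Γ.IsFirstReturn G₀ ((Γ.contract G₀).r β) β.edges :=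
  isFirstReturn_of_isPath β.isPath β.ne_nil ((Γ.contract G₀).s β).2 β.inner

theorem IsFirstReturn.exists_contractedEdge {p : V} {l : List E}
    (h : Γ.IsFirstReturn G₀ p l) (hp : p ∈ G₀) :
    ∃ β : Γ.ContractedEdge G₀, β.edges = l ∧ (Γ.contract G₀).r β = ⟨p, hp⟩ := by
  obtain ⟨q, hq, hl⟩ := h.exists_isPath
  exact ⟨⟨l, h.ne_nil, hl.isChain, by rw [h.range_head]; exact hp, h.getLast_mem, h.inner⟩, rfl,
    Subtype.ext h.range_head⟩

/-! ### Regular vertices of the contracted graph -/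

/-- A vertex outside `G₀` that no infinite path of the complement enters is the range of a path
from `G₀`. -/
theorem exists_isFirstReturn (hsing : ∀ p, Γ.IsSingular p → p ∈ G₀) {p : V} (hp : p ∉ G₀)
    (h : ∀ x, ¬ Γ.Avoids G₀ p x) : ∃ l, Γ.IsFirstReturn G₀ p l := by
  by_contra hno
  obtain ⟨x, hx⟩ := exists_avoids (Γ := Γ) (G₀ := G₀)
    (Q := fun p => p ∉ G₀ ∧ ¬ ∃ l, Γ.IsFirstReturn G₀ p l) (fun p ⟨hp, hl⟩ => by
      obtain ⟨e, rfl⟩ := exists_range_eq fun hs => hp (hsing p hs)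
      have hs : Γ.s e ∉ G₀ := fun hs => hl ⟨_, .single e hs⟩
      exact ⟨e, rfl, hs, hs, fun ⟨l, h⟩ => hl ⟨_, .cons e hs h⟩⟩) ⟨hp, hno⟩
  exact h x hx

theorem exists_isFirstReturn_cons (hsing : ∀ p, Γ.IsSingular p → p ∈ G₀) (e : E)
    (h : Γ.s e ∉ G₀ → ∀ x, ¬ Γ.Avoids G₀ (Γ.s e) x) :
    ∃ l, Γ.IsFirstReturn G₀ (Γ.r e) (e :: l) := by
  by_cases hs : Γ.s e ∈ G₀
  · exact ⟨[], .single e hs⟩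
  · obtain ⟨l, hl⟩ := exists_isFirstReturn hsing hs (h hs)
    exact ⟨l, .cons e hs hl⟩

theorem Avoids.reaches {p : V} {x : ℕ → E} (h : Γ.Avoids G₀ p x) (hp : p ∈ G₀) (i : ℕ) :
    Γ.Reaches G₀ (Γ.r (x i)) := by
  induction i with
  | zero => rw [h.2.1]; exact .base hp
  | succ i ih => rw [← h.1 i]; exact .step _ ih

/-- Paths that branch off an infinite path extend to paths of the contracted graph. -/
theorem Avoids.exists_isFirstReturn_length {p : V} {x : ℕ → E} (h : Γ.Avoids G₀ p x) (i : ℕ)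
    {l : List E} (hl : Γ.IsFirstReturn G₀ (Γ.r (x i)) l) :
    ∃ m, Γ.IsFirstReturn G₀ p m ∧ i + l.length ≤ m.length := by
  induction i generalizing l with
  | zero => exact ⟨l, by rwa [h.2.1] at hl, by simp⟩
  | succ i ih =>
    rw [← h.1 i] at hl
    obtain ⟨m, hm, hlen⟩ := ih (.cons (x i) (h.2.2 i) hl)
    exact ⟨m, hm, by simp only [List.length_cons] at hlen; omega⟩

/-- A vertex that is regular in the contracted graph is regular in the graph, and no infinite path
with sources outside `G₀` ends there: such a path would be a head from some point on, or have
infinitely many edges branching off, which gives infinitely many edges of the contracted graph. -/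
theorem regular_of_contract (hhead : ∀ x : ℕ → E, ¬ Γ.IsHead x)
    (hsing : ∀ p, Γ.IsSingular p → p ∈ G₀) (hacyclic : Γ.AcyclicOn (Γ.complEdges G₀))
    (hT1 : Γ.CondT1 G₀) (hT3 : Γ.CondT3 G₀) (p : G₀)
    (hp : ¬ (Γ.contract G₀).IsSingular p) :
    ¬ Γ.IsSingular (p : V) ∧ ∀ x, ¬ Γ.Avoids G₀ p x := by
  have hfin := finite_of_not_isSingular hp
  constructor
  · rintro (h0 | hinf)
    · obtain ⟨β, hβ⟩ := exists_range_eq hp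
      refine (Set.eq_empty_iff_forall_notMem.mp h0) (β.edges.head β.ne_nil) ?_
      exact congrArg Subtype.val hβ
    · refine hinf ?_
      -- all but at most one of the edges into `p` are first edges of contracted edges
      have hsub : {e | Γ.r e = p} ⊆
          ((fun β : Γ.ContractedEdge G₀ => β.edges.head β.ne_nil) ''
            {β | (Γ.contract G₀).r β = p}) ∪
          {e | Γ.r e = p ∧ Γ.s e ∉ G₀ ∧ ∃ x, Γ.Avoids G₀ (Γ.s e) x} := by
        intro e he
        by_cases hx : Γ.s e ∉ G₀ ∧ ∃ x, Γ.Avoids G₀ (Γ.s e) x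
        · exact Or.inr ⟨he, hx⟩
        · left
          obtain ⟨l, hl⟩ := exists_isFirstReturn_cons hsing e fun hs x hxa => hx ⟨hs, x, hxa⟩
          have he' : Γ.r e = p := he
          rw [he'] at hl
          obtain ⟨β, hβ, hr⟩ := hl.exists_contractedEdge p.2
          refine ⟨β, hr, ?_⟩
          simp [hβ]
      refine ((hfin.image _).union (Set.Subsingleton.finite ?_)).subset hsub
      rintro e ⟨he, hs, x, hx⟩ f ⟨hf, hs', y, hy⟩
      have h1 := hx.cons hs
      have h2 := hy.cons hs'
      rw [he] at h1
      rw [hf] at h2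
      exact congrFun (hT1.eq_of_avoids (.base p.2) h1 h2) 0
  · intro x hx
    -- contracted edges with range `p` have bounded length
    obtain ⟨n, hn⟩ : ∃ n, ∀ β : Γ.ContractedEdge G₀, (Γ.contract G₀).r β = p →
        β.edges.length ≤ n := by
      obtain ⟨n, hn⟩ := (hfin.image fun β => β.edges.length).bddAbove
      exact ⟨n, fun β hβ => hn ⟨β, hβ, rfl⟩⟩
    have hy := (hx.shift n).tail
    have hyT := hy.isComplInfPath ((hx.shift n).2.2 0)
    refine hhead _ ⟨hyT.1, fun α hα hmem => hacyclic α hα fun e he => ?_, fun i f hf => ?_,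
      fun i f hf => ?_⟩
    · obtain ⟨i, rfl⟩ := hmem e he
      exact hyT.2 i
    · by_contra hne
      have hxi := hx.shift (i + 1 + n)
      rw [← hf] at hxi
      have hreach := hx.reaches p.2 (i + 1 + n)
      rw [← hf] at hreach
      obtain ⟨l, hl⟩ := exists_isFirstReturn_cons hsing f
        (hT1.not_avoids_of_ne hxi hreach (by simpa using hne))
      rw [hf] at hl
      obtain ⟨m, hm, hlen⟩ := hx.exists_isFirstReturn_length (i + 1 + n) hl
      obtain ⟨β, rfl, hr⟩ := hm.exists_contractedEdge p.2
      have := hn β hr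
      omega
    · have h1 := hyT.1 i
      rw [h1] at hf
      obtain ⟨e, -, he⟩ := hT3 _ hyT (i + 1)
      exact (he f hf).trans (he _ h1).symm

end DirectedGraph

theorem mem_of_add_mem {R : Type w} [CommRing R] {A : Type a} [NonUnitalRing A] [Module R A]
    (X : NonUnitalSubalgebra R A) {y z : A} (h : y + z ∈ X) (hz : z ∈ X) : y ∈ X :=
  (Submodule.add_mem_iff_left X.toSubmodule hz).mp h

/-! ### Morita equivalence with a full corner -/

/-- If `φ : A → B` is injective, `M` and `N` are the one-sided ideals generated by the images of
idempotents of `A`, the range of `φ` is `M N` and `N M = B`, then `M` and `N` form a surjective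
Morita context. -/
theorem areMoritaEquivalent_of_idempotents {R : Type w} [CommRing R] {A B : Type a}
    [NonUnitalRing A] [Module R A] [NonUnitalRing B] [Module R B] [IsScalarTower R B B]
    [SMulCommClass R B B] {φ : A →ₙₐ[R] B} (hφ : Function.Injective φ) {ι : Type x} (e : ι → A)
    (he : ∀ i, e i * e i = e i) {M N : Submodule R B}
    (hM : M = Submodule.span R {z | ∃ i y, z = φ (e i) * y})
    (hN : N = Submodule.span R {z | ∃ i y, z = y * φ (e i)})
    (hMN : ∀ z, z ∈ Submodule.map₂ (LinearMap.mul R B) M N ↔ ∃ c, φ c = z)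
    (hNM : Submodule.map₂ (LinearMap.mul R B) N M = ⊤) :
    AreMoritaEquivalent R A B := by
  have he' : ∀ i, φ (e i) * φ (e i) = φ (e i) := fun i => by rw [← map_mul, he]
  have hMB : ∀ m ∈ M, ∀ b, m * b ∈ M := by
    intro m hm b
    rw [hM] at hm ⊢
    induction hm using Submodule.span_induction with
    | mem z hz =>
      obtain ⟨i, y, rfl⟩ := hz
      exact Submodule.subset_span ⟨i, y * b, mul_assoc _ _ _⟩
    | zero => rw [zero_mul]; exact zero_mem _
    | add y z _ _ hy hz => rw [add_mul]; exact add_mem hy hz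
    | smul c z _ hz => rw [smul_mul_assoc]; exact Submodule.smul_mem _ _ hz
  have hBN : ∀ n ∈ N, ∀ b, b * n ∈ N := by
    intro n hn b
    rw [hN] at hn ⊢
    induction hn using Submodule.span_induction with
    | mem z hz =>
      obtain ⟨i, y, rfl⟩ := hz
      exact Submodule.subset_span ⟨i, b * y, (mul_assoc _ _ _).symm⟩
    | zero => rw [mul_zero]; exact zero_mem _
    | add y z _ _ hy hz => rw [mul_add]; exact add_mem hy hz
    | smul c z _ hz => rw [mul_smul_comm]; exact Submodule.smul_mem _ _ hz
  have hφM : ∀ c, φ c ∈ M := fun c => by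
    have h := (hMN (φ c)).mpr ⟨c, rfl⟩
    exact Submodule.map₂_le.mpr (fun m hm n _ => hMB m hm n) h
  have hφN : ∀ c, φ c ∈ N := fun c => by
    have h := (hMN (φ c)).mpr ⟨c, rfl⟩
    exact Submodule.map₂_le.mpr (fun m _ n hn => hBN n hn m) h
  have hpair : ∀ (m : M) (n : N), ∃ c, φ c = (m : B) * n := fun m n =>
    (hMN _).mp (Submodule.apply_mem_map₂ _ m.2 n.2)
  choose p hp using hpair
  let lM : A →ₗ[R] M →ₗ[R] M := LinearMap.mk₂ R (fun c m => ⟨φ c * m, hMB _ (hφM c) m⟩)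
    (fun c d m => Subtype.ext (by simp [add_mul]))
    (fun c d m => Subtype.ext (by simp [smul_mul_assoc]))
    (fun c m n => Subtype.ext (by simp [mul_add]))
    (fun c d m => Subtype.ext (by simp [mul_smul_comm]))
  let rM : M →ₗ[R] B →ₗ[R] M := LinearMap.mk₂ R (fun m b => ⟨m * b, hMB _ m.2 b⟩)
    (fun c d m => Subtype.ext (by simp [add_mul]))
    (fun c d m => Subtype.ext (by simp [smul_mul_assoc]))
    (fun c m n => Subtype.ext (by simp [mul_add]))
    (fun c d m => Subtype.ext (by simp [mul_smul_comm]))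
  let lN : B →ₗ[R] N →ₗ[R] N := LinearMap.mk₂ R (fun b n => ⟨b * n, hBN _ n.2 b⟩)
    (fun c d m => Subtype.ext (by simp [add_mul]))
    (fun c d m => Subtype.ext (by simp [smul_mul_assoc]))
    (fun c m n => Subtype.ext (by simp [mul_add]))
    (fun c d m => Subtype.ext (by simp [mul_smul_comm]))
  let rN : N →ₗ[R] A →ₗ[R] N := LinearMap.mk₂ R (fun n c => ⟨n * φ c, hBN _ (hφN c) n⟩)
    (fun c d m => Subtype.ext (by simp [add_mul]))
    (fun c d m => Subtype.ext (by simp [smul_mul_assoc]))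
    (fun c m n => Subtype.ext (by simp [mul_add]))
    (fun c d m => Subtype.ext (by simp [mul_smul_comm]))
  let ψ : M →ₗ[R] N →ₗ[R] A := LinearMap.mk₂ R p
    (fun c d m => hφ (by simp [hp, add_mul]))
    (fun c d m => hφ (by simp [hp, smul_mul_assoc]))
    (fun c m n => hφ (by simp [hp, mul_add]))
    (fun c d m => hφ (by simp [hp, mul_smul_comm]))
  let χ : N →ₗ[R] M →ₗ[R] B := LinearMap.mk₂ R (fun n m => (n : B) * m)
    (fun c d m => by simp [add_mul])
    (fun c d m => by simp [smul_mul_assoc])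
    (fun c m n => by simp [mul_add])
    (fun c d m => by simp [mul_smul_comm])
  have hlM : ∀ c m, (lM c m : B) = φ c * m := fun _ _ => rfl
  have hrM : ∀ m b, (rM m b : B) = m * b := fun _ _ => rfl
  have hlN : ∀ b n, (lN b n : B) = b * n := fun _ _ => rfl
  have hrN : ∀ n c, (rN n c : B) = n * φ c := fun _ _ => rfl
  have hψ : ∀ m n, φ (ψ m n) = m * n := hp
  have hχ : ∀ n m, χ n m = n * m := fun _ _ => rfl
  -- a submodule of `M` (or `N`) is everything once it contains the generators
  have topM : ∀ S : Submodule R M, (∀ i y h, (⟨φ (e i) * y, h⟩ : M) ∈ S) → S = ⊤ := by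
    intro S hS
    have hle : M ≤ S.map M.subtype := by
      conv_lhs => rw [hM]
      refine Submodule.span_le.mpr ?_
      rintro _ ⟨i, y, rfl⟩
      exact ⟨⟨_, hMB _ (hφM _) _⟩, hS i y _, rfl⟩
    rw [Submodule.eq_top_iff']
    intro m
    obtain ⟨m', hm', heq⟩ := hle m.2
    rwa [← Subtype.ext heq]
  have topN : ∀ S : Submodule R N, (∀ i y h, (⟨y * φ (e i), h⟩ : N) ∈ S) → S = ⊤ := by
    intro S hS
    have hle : N ≤ S.map N.subtype := by
      conv_lhs => rw [hN]
      refine Submodule.span_le.mpr ?_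
      rintro _ ⟨i, y, rfl⟩
      exact ⟨⟨_, hBN _ (hφN _) _⟩, hS i y _, rfl⟩
    rw [Submodule.eq_top_iff']
    intro m
    obtain ⟨m', hm', heq⟩ := hle m.2
    rwa [← Subtype.ext heq]
  refine ⟨M, inferInstance, inferInstance, N, inferInstance, inferInstance, ⟨?_⟩⟩
  exact
    { lM := lM, rM := rM, lN := lN, rN := rN, ψ := ψ, φ := χ
      lM_mul := fun c d m => Subtype.ext (by simp only [hlM, map_mul, mul_assoc])
      rM_mul := fun m c d => Subtype.ext (by simp only [hrM, mul_assoc])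
      lM_rM := fun c m d => Subtype.ext (by simp only [hlM, hrM, mul_assoc])
      lN_mul := fun c d n => Subtype.ext (by simp only [hlN, mul_assoc])
      rN_mul := fun n c d => Subtype.ext (by simp only [hrN, map_mul, mul_assoc])
      lN_rN := fun c n d => Subtype.ext (by simp only [hlN, hrN, mul_assoc])
      lM_unital := topM _ fun i y h => Submodule.subset_span
        ⟨e i, ⟨_, h⟩, Subtype.ext (by simp only [hlM, ← mul_assoc, he'])⟩
      rM_unital := topM _ fun i y h => Submodule.subset_span
        ⟨⟨_, hφM (e i)⟩, y, Subtype.ext (by simp only [hrM])⟩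
      lN_unital := topN _ fun i y h => Submodule.subset_span
        ⟨y, ⟨_, hφN (e i)⟩, Subtype.ext (by simp only [hlN])⟩
      rN_unital := topN _ fun i y h => Submodule.subset_span
        ⟨⟨_, h⟩, e i, Subtype.ext (by simp only [hrN, mul_assoc, he'])⟩
      ψ_balanced := fun m c n => hφ (by simp only [hψ, hrM, hlN, mul_assoc])
      φ_balanced := fun n c m => by simp only [hχ, hrN, hlM, mul_assoc]
      ψ_left := fun c m n => hφ (by simp only [hψ, hlM, map_mul, mul_assoc])
      ψ_right := fun m n c => hφ (by simp only [hψ, hrN, map_mul, mul_assoc])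
      φ_left := fun c n m => by simp only [hχ, hlN, mul_assoc]
      φ_right := fun n m c => by simp only [hχ, hrM, mul_assoc]
      ψ_assoc := fun m n m' => Subtype.ext (by simp only [hlM, hrM, hψ, hχ, mul_assoc])
      φ_assoc := fun n m n' => Subtype.ext (by simp only [hlN, hrN, hψ, hχ, mul_assoc])
      ψ_surjective := by
        rw [Submodule.eq_top_iff']
        intro c
        have h : Submodule.map₂ (LinearMap.mul R B) M N ≤
            (Submodule.span R {z | ∃ m n, ψ m n = z}).map (φ : A →ₗ[R] B) :=
          Submodule.map₂_le.mpr fun m hm n hn =>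
            ⟨ψ ⟨m, hm⟩ ⟨n, hn⟩, Submodule.subset_span ⟨_, _, rfl⟩, hψ _ _⟩
        obtain ⟨c', hc', heq⟩ := h ((hMN (φ c)).mpr ⟨c, rfl⟩)
        rwa [← hφ heq]
      φ_surjective := by
        rw [eq_top_iff, ← hNM]
        exact Submodule.map₂_le.mpr fun n hn m hm =>
          Submodule.subset_span ⟨⟨n, hn⟩, ⟨m, hm⟩, rfl⟩ }

namespace LeavittPathAlgebra

open DirectedGraph

variable {R : Type w} [CommRing R] {V : Type u} {E : Type v} {Γ : DirectedGraph V E} {G₀ : Set V}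

/-! ### The modules `M` and `M*` -/

theorem spanM_eq :
    spanM R Γ G₀ = Submodule.span R {z | ∃ (p : G₀) (y : _), z = vert R Γ p * y} := by
  refine le_antisymm (Submodule.span_le.mpr ?_) (Submodule.span_le.mpr ?_)
  · rintro _ ⟨μ, ν, hμ, rfl⟩
    refine Submodule.subset_span ⟨⟨_, hμ⟩, path R μ * ghostPath R ν, ?_⟩
    rw [← mul_assoc, path, vert_mul_pathAux μ.isPath]
  · rintro _ ⟨p, y, rfl⟩
    have hy : y ∈ Submodule.span R (monomials R Γ ⊤) := by rw [span_monomials]; trivial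
    change vert R Γ p * y ∈ spanM R Γ G₀
    induction hy using Submodule.span_induction with
    | mem z hz =>
      obtain ⟨q, l, q', m, t, h, h', -, rfl⟩ := hz
      by_cases hp : (p : V) = q
      · subst hp
        obtain ⟨μ, hμ, rfl⟩ := h.exists_finPath
        obtain ⟨ν, rfl, rfl⟩ := h'.exists_finPath
        rw [← mul_assoc, vert_mul_pathAux h]
        refine Submodule.subset_span ⟨μ, ν, by rw [hμ]; exact p.2, ?_⟩
        rw [path, ghostPath, hμ]
      · rw [← vert_mul_pathAux h, ← mul_assoc, ← mul_assoc, vert_mul_vert_of_ne hp, zero_mul,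
          zero_mul]
        exact zero_mem _
    | zero => rw [mul_zero]; exact zero_mem _
    | add y z _ _ hy hz => rw [mul_add]; exact add_mem hy hz
    | smul c z _ hz => rw [mul_smul_comm]; exact Submodule.smul_mem _ _ hz

theorem spanMStar_eq :
    spanMStar R Γ G₀ = Submodule.span R {z | ∃ (p : G₀) (y : _), z = y * vert R Γ p} := by
  refine le_antisymm (Submodule.span_le.mpr ?_) (Submodule.span_le.mpr ?_)
  · rintro _ ⟨μ, ν, hν, rfl⟩
    refine Submodule.subset_span ⟨⟨_, hν⟩, path R μ * ghostPath R ν, ?_⟩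
    rw [mul_assoc, ghostPath, ghostPathAux_mul_vert ν.isPath]
  · rintro _ ⟨p, y, rfl⟩
    have hy : y ∈ Submodule.span R (monomials R Γ ⊤) := by rw [span_monomials]; trivial
    change y * vert R Γ p ∈ spanMStar R Γ G₀
    induction hy using Submodule.span_induction with
    | mem z hz =>
      obtain ⟨q, l, q', m, t, h, h', -, rfl⟩ := hz
      by_cases hp : q' = p
      · subst hp
        obtain ⟨μ, rfl, rfl⟩ := h.exists_finPath
        obtain ⟨ν, hν, rfl⟩ := h'.exists_finPath
        rw [mul_assoc, ghostPathAux_mul_vert h']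
        refine Submodule.subset_span ⟨μ, ν, by rw [hν]; exact p.2, ?_⟩
        rw [path, ghostPath, hν]
      · rw [← ghostPathAux_mul_vert h', mul_assoc, mul_assoc, vert_mul_vert_of_ne hp, mul_zero,
          mul_zero]
        exact zero_mem _
    | zero => rw [zero_mul]; exact zero_mem _
    | add y z _ _ hy hz => rw [add_mul]; exact add_mem hy hz
    | smul c z _ hz => rw [smul_mul_assoc]; exact Submodule.smul_mem _ _ hz

theorem mul_mem_mulSpan (p q : G₀) (y z : LeavittPathAlgebra R Γ) :
    (vert R Γ p * y) * (z * vert R Γ q) ∈ mulSpan R (spanM R Γ G₀) (spanMStar R Γ G₀) := by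
  rw [spanM_eq, spanMStar_eq]
  exact Submodule.apply_mem_map₂ _ (Submodule.subset_span ⟨p, y, rfl⟩)
    (Submodule.subset_span ⟨q, z, rfl⟩)

/-! ### Fullness of `G₀` -/

/-- `M* M` is the ideal generated by `G₀`; it is hereditary and saturated, so it contains each
vertex. -/
theorem mulSpan_spanMStar_spanM (hsing : ∀ p, Γ.IsSingular p → p ∈ G₀) (hT2 : Γ.CondT2 G₀) :
    mulSpan R (spanMStar R Γ G₀) (spanM R Γ G₀) = ⊤ := by
  set I := mulSpan R (spanMStar R Γ G₀) (spanM R Γ G₀) with hI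
  have hIspan : I = Submodule.span R (Set.image2 (fun m n => LinearMap.mul R _ m n)
      {z | ∃ (p : G₀) (y : _), z = y * vert R Γ p}
      {z | ∃ (p : G₀) (y : _), z = vert R Γ p * y}) := by
    rw [hI, spanM_eq, spanMStar_eq, mulSpan, Submodule.map₂_span_span]
  have hleft : ∀ c, ∀ y ∈ I, c * y ∈ I := by
    intro c y hy
    rw [hIspan] at hy ⊢
    induction hy using Submodule.span_induction with
    | mem z hz =>
      obtain ⟨_, ⟨p, m, rfl⟩, _, ⟨q, n, rfl⟩, rfl⟩ := hz
      refine Submodule.subset_span ⟨_, ⟨p, c * m, rfl⟩, _, ⟨q, n, rfl⟩, ?_⟩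
      simp only [LinearMap.mul_apply', mul_assoc]
    | zero => rw [mul_zero]; exact zero_mem _
    | add y z _ _ hy hz => rw [mul_add]; exact add_mem hy hz
    | smul c z _ hz => rw [mul_smul_comm]; exact Submodule.smul_mem _ _ hz
  have hright : ∀ c, ∀ y ∈ I, y * c ∈ I := by
    intro c y hy
    rw [hIspan] at hy ⊢
    induction hy using Submodule.span_induction with
    | mem z hz =>
      obtain ⟨_, ⟨p, m, rfl⟩, _, ⟨q, n, rfl⟩, rfl⟩ := hz
      refine Submodule.subset_span ⟨_, ⟨p, m, rfl⟩, _, ⟨q, n * c, rfl⟩, ?_⟩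
      simp only [LinearMap.mul_apply', mul_assoc]
    | zero => rw [zero_mul]; exact zero_mem _
    | add y z _ _ hy hz => rw [add_mul]; exact add_mem hy hz
    | smul c z _ hz => rw [smul_mul_assoc]; exact Submodule.smul_mem _ _ hz
  have hbase : ∀ p ∈ G₀, vert R Γ p ∈ I := by
    intro p hp
    rw [hIspan]
    refine Submodule.subset_span ⟨_, ⟨⟨p, hp⟩, vert R Γ p, rfl⟩, _, ⟨⟨p, hp⟩, vert R Γ p, rfl⟩, ?_⟩
    simp only [LinearMap.mul_apply', vert_mul_vert]
  have hreach : ∀ p, Γ.Reaches G₀ p → vert R Γ p ∈ I := by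
    intro p hp
    induction hp with
    | base hp => exact hbase _ hp
    | step e _ ih =>
      rw [← ghost_mul_edge, ← vert_mul_edge]
      exact hleft _ _ (hright _ _ ih)
  have hvert : ∀ p, vert R Γ p ∈ I := by
    intro p
    by_contra hp
    obtain ⟨x, hx⟩ := exists_avoids (Γ := Γ) (G₀ := G₀) (Q := fun p => vert R Γ p ∉ I)
      (fun p hp => by
        have hns : ¬ Γ.IsSingular p := fun hs => hp (hbase p (hsing p hs))
        by_contra hno
        push Not at hno
        refine hp ?_
        rw [(isLeavittFamily R Γ).sum_eq p hns (finite_of_not_isSingular hns)]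
        refine Submodule.sum_mem _ fun e he => ?_
        rw [← edge_mul_vert]
        refine hright _ _ (hleft _ _ ?_)
        by_cases hs : Γ.s e ∈ G₀
        · exact hbase _ hs
        · exact hno e ((finite_of_not_isSingular hns).mem_toFinset.mp he) hs) hp
    exact hp (hreach p (hT2.reaches hx))
  rw [eq_top_iff, ← span_monomials]
  refine Submodule.span_le.mpr ?_
  rintro _ ⟨p, l, q, m, t, h, h', -, rfl⟩
  rw [← pathAux_mul_vert h]
  exact hright _ _ (hleft _ _ (hvert t))

/-! ### The Leavitt family of the contracted graph -/

theorem path_toFinPath (β : Γ.ContractedEdge G₀) :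
    path R β.toFinPath = pathAux R Γ ((Γ.contract G₀).r β) β.edges := rfl

theorem ghostPath_toFinPath (β : Γ.ContractedEdge G₀) :
    ghostPath R β.toFinPath = ghostPathAux R Γ ((Γ.contract G₀).r β) β.edges := rfl

/-- No first return path is a proper initial segment of another. -/
theorem ghostPathAux_mul_pathAux_of_ne {p q : V} {l m : List E} (hl : Γ.IsFirstReturn G₀ p l)
    (hm : Γ.IsFirstReturn G₀ q m) (hne : l ≠ m) :
    ghostPathAux R Γ p l * pathAux R Γ q m = 0 := by
  induction hl generalizing q m with
  | single e he =>
    cases hm with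
    | single f hf => exact ghostPathAux_cons_mul_pathAux_cons_of_ne fun h => hne (by rw [h])
    | cons f hf hm => exact ghostPathAux_cons_mul_pathAux_cons_of_ne fun h => hf (h ▸ he)
  | cons e he hl ih =>
    cases hm with
    | single f hf => exact ghostPathAux_cons_mul_pathAux_cons_of_ne fun h => he (h ▸ hf)
    | cons f hf hm =>
      by_cases hef : e = f
      · subst hef
        obtain ⟨t, -, ht⟩ := hm.exists_isPath
        rw [ghostPathAux_cons_mul_pathAux_cons ht]
        exact ih hm fun h => hne (by rw [h])
      · exact ghostPathAux_cons_mul_pathAux_cons_of_ne hef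

/-- The Cuntz–Krieger relation of the contracted graph: the difference of the two sides is
annihilated by the ghost paths of all contracted edges, and a failure would propagate along an
infinite path with sources outside `G₀`. -/
theorem vert_eq_sum_contract (hsing : ∀ p, Γ.IsSingular p → p ∈ G₀) (p : G₀)
    (hp : ¬ Γ.IsSingular (p : V)) (hx : ∀ x, ¬ Γ.Avoids G₀ p x)
    (hfin : {β | (Γ.contract G₀).r β = p}.Finite) :
    vert R Γ p = ∑ β ∈ hfin.toFinset, path R β.toFinPath * ghostPath R β.toFinPath := by
  classical
  set T := ∑ β ∈ hfin.toFinset, path R β.toFinPath * ghostPath R β.toFinPath with hT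
  have hkill : ∀ β : Γ.ContractedEdge G₀, (Γ.contract G₀).r β = p →
      ghostPathAux R Γ p β.edges * vert R Γ p = ghostPathAux R Γ p β.edges * T := by
    rintro β rfl
    rw [ghostPathAux_mul_vert β.isPath, hT, Finset.mul_sum, Finset.sum_eq_single β]
    · rw [path_toFinPath, ghostPath_toFinPath, ← mul_assoc,
        ghostPathAux_mul_pathAux β.isPath, vert_mul_ghostPathAux β.isPath]
    · intro γ _ hγ
      rw [path_toFinPath, ← mul_assoc,
        ghostPathAux_mul_pathAux_of_ne β.isFirstReturn γ.isFirstReturn, zero_mul]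
      exact fun h => hγ (ContractedEdge.eq_of_edges_eq h.symm)
    · exact fun h => absurd (hfin.mem_toFinset.mpr rfl) h
  have hvT : vert R Γ p * T = T := by
    rw [hT, Finset.mul_sum]
    refine Finset.sum_congr rfl fun β hβ => ?_
    obtain rfl : (Γ.contract G₀).r β = p := hfin.mem_toFinset.mp hβ
    rw [path_toFinPath, ← mul_assoc, vert_mul_pathAux β.isPath]
  by_contra hne
  obtain ⟨x, hx'⟩ := exists_avoids (Γ := Γ) (G₀ := G₀)
    (Q := fun q => ∃ l, Γ.IsPath p l q ∧ (∀ e ∈ l, Γ.s e ∉ G₀) ∧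
      ghostPathAux R Γ p l * vert R Γ p ≠ ghostPathAux R Γ p l * T)
    (by
      rintro q ⟨l, hl, hin, hq⟩
      have hns : ¬ Γ.IsSingular q := by
        by_cases hl0 : l = []
        · subst hl0
          rwa [← hl.eq_of_nil]
        · obtain ⟨m, e, rfl, rfl, -⟩ := hl.exists_concat hl0
          exact fun hs => hin e (by simp) (hsing _ hs)
      obtain ⟨e, he, hne⟩ : ∃ e, Γ.r e = q ∧ ghost R Γ e * (ghostPathAux R Γ p l * vert R Γ p) ≠
          ghost R Γ e * (ghostPathAux R Γ p l * T) := by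
        by_contra hno
        push Not at hno
        refine hq ?_
        rw [← vert_mul_ghostPathAux hl,
          (isLeavittFamily R Γ).sum_eq q hns (finite_of_not_isSingular hns), mul_assoc, mul_assoc,
          Finset.sum_mul, Finset.sum_mul]
        refine Finset.sum_congr rfl fun e he => ?_
        rw [mul_assoc, mul_assoc, hno e ((finite_of_not_isSingular hns).mem_toFinset.mp he)]
      subst he
      rw [← mul_assoc, ← mul_assoc, ← ghostPathAux_concat hl] at hne
      have hs : Γ.s e ∉ G₀ := by
        intro hs
        obtain ⟨β, hβ, hr⟩ := (isFirstReturn_of_isPath (hl.concat rfl) (by simp) hs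
          (by simpa using hin)).exists_contractedEdge p.2
        rw [← hβ] at hne
        exact hne (hkill β hr)
      refine ⟨e, rfl, hs, l ++ [e], hl.concat rfl, fun f hf => ?_, hne⟩
      rcases List.mem_append.mp hf with hf | hf
      · exact hin f hf
      · obtain rfl : f = e := by simpa using hf
        exact hs)
    (p := (p : V)) ⟨[], .nil _, by simp, by rwa [ghostPathAux, vert_mul_vert, hvT]⟩
  exact hx x hx'

theorem isLeavittFamily_contract (hhead : ∀ x : ℕ → E, ¬ Γ.IsHead x)
    (hsing : ∀ p, Γ.IsSingular p → p ∈ G₀) (hacyclic : Γ.AcyclicOn (Γ.complEdges G₀))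
    (hT1 : Γ.CondT1 G₀) (hT3 : Γ.CondT3 G₀) :
    (Γ.contract G₀).IsLeavittFamily (fun p : G₀ => vert R Γ p)
      (fun β => path R β.toFinPath) (fun β => ghostPath R β.toFinPath) where
  idem _ := vert_mul_vert _
  orth _ _ h := vert_mul_vert_of_ne fun h' => h (Subtype.ext h')
  r_edge β := vert_mul_pathAux β.isPath
  edge_s β := pathAux_mul_vert β.isPath
  s_ghost β := vert_mul_ghostPathAux β.isPath
  ghost_r β := ghostPathAux_mul_vert β.isPath
  ghost_edge β := ghostPathAux_mul_pathAux β.isPath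
  ghost_edge_ne β γ h := ghostPathAux_mul_pathAux_of_ne β.isFirstReturn γ.isFirstReturn
    fun h' => h (ContractedEdge.eq_of_edges_eq h')
  sum_eq p hp hfin :=
    have h := regular_of_contract hhead hsing hacyclic hT1 hT3 p hp
    vert_eq_sum_contract hsing p h.1 h.2 hfin

/-- Pulling a branching representation back to the contracted graph gives a branching
representation, so the homomorphism from its Leavitt path algebra is injective. -/
theorem injective_of_contract [Countable E]
    {φ : LeavittPathAlgebra R (Γ.contract G₀) →ₙₐ[R] LeavittPathAlgebra R Γ}
    (hv : ∀ p : G₀, φ (vert R (Γ.contract G₀) p) = vert R Γ (p : V))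
    (hg : ∀ β : Γ.ContractedEdge G₀, φ (ghost R (Γ.contract G₀) β) = ghostPath R β.toFinPath) :
    Function.Injective φ := by
  obtain ⟨θ, act, hθ⟩ := exists_isBranching R Γ
  have : IsBranching (θ.comp φ) (fun p : G₀ => {z : V × ℕ × ℤ | z.1 = p})
      (fun β z => β.edges.foldr act z) (fun z => z.2.2) :=
    { nonempty := fun p => hθ.nonempty p
      maps := fun β z hz => hθ.foldr_mem β.isPath hz
      deg_lt := fun β z hz => by
        obtain ⟨e, l, hel⟩ := List.exists_cons_of_ne_nil β.ne_nil
        have h := β.isPath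
        rw [hel] at h ⊢
        exact hθ.deg_lt_foldr h hz
      vert_apply := fun p g z hz => by
        rw [NonUnitalAlgHom.comp_apply, hv]
        exact hθ.vert_apply p g z hz
      ghost_apply := fun β g z hz => by
        rw [NonUnitalAlgHom.comp_apply, hg]
        exact hθ.ghostPathAux_apply β.isPath g hz }
  have h := this.injective
  rw [NonUnitalAlgHom.coe_comp] at h
  exact h.of_comp

/-! ### The corner `M M*` -/

section Corner

variable {X : NonUnitalSubalgebra R (LeavittPathAlgebra R Γ)}
  (hXv : ∀ p ∈ G₀, vert R Γ p ∈ X)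
  (hXp : ∀ p ∈ G₀, ∀ l, Γ.IsFirstReturn G₀ p l → pathAux R Γ p l ∈ X)
  (hXg : ∀ p ∈ G₀, ∀ l, Γ.IsFirstReturn G₀ p l → ghostPathAux R Γ p l ∈ X)

/-- A path with source in `G₀` decomposes into a first return path and a path with both ends in
`G₀`. -/
theorem exists_firstReturn_append {p q : V} {l : List E} (h : Γ.IsPath p l q) (hq : q ∈ G₀)
    (hl : l ≠ []) : ∃ m k t, l = m ++ k ∧ Γ.IsFirstReturn G₀ p m ∧ Γ.IsPath p m t ∧
      Γ.IsPath t k q ∧ t ∈ G₀ := by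
  induction h with
  | nil => exact absurd rfl hl
  | @cons e l q h ih =>
    by_cases hs : Γ.s e ∈ G₀
    · exact ⟨[e], l, _, rfl, .single e hs, .cons e (.nil _), h, hs⟩
    · have hl0 : l ≠ [] := by
        rintro rfl
        exact hs (h.eq_of_nil ▸ hq)
      obtain ⟨m, k, t, rfl, h1, h2, h3, h4⟩ := ih hq hl0
      exact ⟨e :: m, k, t, rfl, .cons e hs h1, .cons e h2, h3, h4⟩

include hXv hXp hXg

theorem pathAux_mem_of_isPath {p q : V} {l : List E} (h : Γ.IsPath p l q) (hp : p ∈ G₀)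
    (hq : q ∈ G₀) : pathAux R Γ p l ∈ X ∧ ghostPathAux R Γ p l ∈ X := by
  induction hn : l.length using Nat.strong_induction_on generalizing p l with
  | _ n ih =>
    by_cases hl : l = []
    · subst hl
      exact ⟨hXv p hp, hXv p hp⟩
    · obtain ⟨m, k, t, rfl, hm, hm', hk, ht⟩ := exists_firstReturn_append h hq hl
      have hlen : k.length < n := by
        have := List.length_pos_iff.mpr hm.ne_nil
        rw [← hn, List.length_append]
        omega
      obtain ⟨h1, h2⟩ := ih _ hlen hk ht rfl
      rw [pathAux_append hm' hk, ghostPathAux_append hm' hk]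
      exact ⟨mul_mem (hXp p hp m hm) h1, mul_mem h2 (hXg p hp m hm)⟩

omit hXv hXp hXg

variable (R Γ G₀ X) in
/-- All `s_μ s_{ν*}` with `s(μ) = s(ν) = t` and with ranges in `G₀` lie in `X`. -/
def CornerAt (t : V) : Prop :=
  ∀ p l q m, Γ.IsPath p l t → Γ.IsPath q m t → p ∈ G₀ → q ∈ G₀ →
    pathAux R Γ p l * ghostPathAux R Γ q m ∈ X

/-- The property passes from the sources of the edges into a regular vertex to that vertex. -/
theorem cornerAt_of_incoming {t : V} (ht : ¬ Γ.IsSingular t)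
    (h : ∀ e, Γ.r e = t → CornerAt R Γ G₀ X (Γ.s e)) : CornerAt R Γ G₀ X t := by
  intro p l q m hl hm hp hq
  rw [← pathAux_mul_vert hl, (isLeavittFamily R Γ).sum_eq t ht (finite_of_not_isSingular ht),
    Finset.mul_sum, Finset.sum_mul]
  refine sum_mem fun e he => ?_
  obtain rfl : Γ.r e = t := (finite_of_not_isSingular ht).mem_toFinset.mp he
  rw [← mul_assoc, mul_assoc, ← pathAux_concat hl, ← ghostPathAux_concat hm]
  exact h e rfl _ _ _ _ (hl.concat rfl) (hm.concat rfl) hp hq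

include hXv hXp hXg

theorem cornerAt_of_mem {t : V} (ht : t ∈ G₀) : CornerAt R Γ G₀ X t :=
  fun _ _ _ _ hl hm hp hq => mul_mem (pathAux_mem_of_isPath hXv hXp hXg hl hp ht).1
    (pathAux_mem_of_isPath hXv hXp hXg hm hq ht).2

theorem cornerAt_of_not_avoids (hsing : ∀ p, Γ.IsSingular p → p ∈ G₀) {t : V}
    (ht : ∀ x, ¬ Γ.Avoids G₀ t x) : CornerAt R Γ G₀ X t := by
  by_contra hno
  obtain ⟨x, hx⟩ := exists_avoids (Γ := Γ) (G₀ := G₀) (Q := fun t => ¬ CornerAt R Γ G₀ X t)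
    (fun t hc => by
      have hns : ¬ Γ.IsSingular t := fun hs => hc (cornerAt_of_mem hXv hXp hXg (hsing t hs))
      by_contra hall
      push Not at hall
      refine hc (cornerAt_of_incoming hns fun e he => ?_)
      by_cases hs : Γ.s e ∈ G₀
      · exact cornerAt_of_mem hXv hXp hXg hs
      · exact hall e he hs) hno
  exact ht x hx

/-- On an infinite path of the complement one moves forward instead: there the unique edge `g` out
of a vertex satisfies `s_g s_{g*} = p_{r(g)} - ∑ s_f s_{f*}`, summed over the other edges into
`r(g)`, and no infinite path of the complement enters their sources. -/
theorem cornerAt_of_reaches (hsing : ∀ p, Γ.IsSingular p → p ∈ G₀)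
    (hT1 : Γ.CondT1 G₀) (hT3 : Γ.CondT3 G₀) (hT4 : Γ.CondT4 G₀) {t : V}
    (ht : Γ.Reaches G₀ t) : CornerAt R Γ G₀ X t := by
  classical
  induction ht with
  | base ht => exact cornerAt_of_mem hXv hXp hXg ht
  | step g hreach ih =>
    by_cases hs : Γ.s g ∈ G₀
    · exact cornerAt_of_mem hXv hXp hXg hs
    by_cases hav : ∃ x, Γ.Avoids G₀ (Γ.s g) x
    swap
    · exact cornerAt_of_not_avoids hXv hXp hXg hsing (not_exists.mp hav)
    obtain ⟨x, hx⟩ := hav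
    have hxT := hx.isComplInfPath hs
    have hfin : {f | Γ.r f = Γ.r g}.Finite := hT4 x hxT g hx.2.1.symm
    have hns : ¬ Γ.IsSingular (Γ.r g) := by
      rintro (h0 | hinf)
      · exact (Set.eq_empty_iff_forall_notMem.mp h0) g rfl
      · exact hinf hfin
    have huniq : ∀ e, Γ.s e = Γ.s g → e = g := by
      obtain ⟨e, -, he⟩ := hT3 x hxT 0
      rw [hx.2.1] at he
      exact fun f hf => (he f hf).trans (he g rfl).symm
    have hlast : ∀ p l, Γ.IsPath p l (Γ.s g) → p ∈ G₀ →
        ∃ k, l = k ++ [g] ∧ Γ.IsPath p k (Γ.r g) := by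
      intro p l hl hp
      have hl0 : l ≠ [] := by
        rintro rfl
        exact hs (hl.eq_of_nil ▸ hp)
      obtain ⟨k, e, rfl, he, hk⟩ := hl.exists_concat hl0
      obtain rfl := huniq e he
      exact ⟨k, rfl, hk⟩
    intro p l' q m' hl' hm' hp hq
    obtain ⟨l, rfl, hl⟩ := hlast p l' hl' hp
    obtain ⟨m, rfl, hm⟩ := hlast q m' hm' hq
    have hsum : pathAux R Γ p l * ghostPathAux R Γ q m = ∑ f ∈ hfin.toFinset,
        pathAux R Γ p (l ++ [f]) * ghostPathAux R Γ q (m ++ [f]) := by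
      conv_lhs => rw [← pathAux_mul_vert hl, (isLeavittFamily R Γ).sum_eq _ hns hfin,
        Finset.mul_sum, Finset.sum_mul]
      refine Finset.sum_congr rfl fun f hf => ?_
      have hf' : Γ.r f = Γ.r g := hfin.mem_toFinset.mp hf
      rw [← hf'] at hl hm
      rw [pathAux_concat hl, ghostPathAux_concat hm, mul_assoc, mul_assoc, mul_assoc]
    rw [← Finset.add_sum_erase _ _ (hfin.mem_toFinset.mpr rfl : g ∈ hfin.toFinset)] at hsum
    have hother : ∑ f ∈ hfin.toFinset.erase g,
        pathAux R Γ p (l ++ [f]) * ghostPathAux R Γ q (m ++ [f]) ∈ X := by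
      refine sum_mem fun f hf => ?_
      obtain ⟨hfg, hf⟩ := Finset.mem_erase.mp hf
      have hf' : Γ.r f = Γ.r g := hfin.mem_toFinset.mp hf
      have hc : CornerAt R Γ G₀ X (Γ.s f) := by
        by_cases hsf : Γ.s f ∈ G₀
        · exact cornerAt_of_mem hXv hXp hXg hsf
        · have hgx := hx.cons hs
          rw [← hf'] at hgx hreach
          exact cornerAt_of_not_avoids hXv hXp hXg hsing
            (hT1.not_avoids_of_ne hgx hreach hfg hsf)
      exact hc _ _ _ _ (hl.concat hf') (hm.concat hf') hp hq
    have h := ih p l q m hl hm hp hq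
    rw [hsum] at h
    exact mem_of_add_mem (A := LeavittPathAlgebra R Γ) X h hother

theorem mulSpan_spanM_spanMStar_le (hsing : ∀ p, Γ.IsSingular p → p ∈ G₀)
    (hT1 : Γ.CondT1 G₀) (hT2 : Γ.CondT2 G₀) (hT3 : Γ.CondT3 G₀) (hT4 : Γ.CondT4 G₀) :
    mulSpan R (spanM R Γ G₀) (spanMStar R Γ G₀) ≤ X.toSubmodule := by
  have hall : ∀ t, CornerAt R Γ G₀ X t := fun t => by
    by_cases hav : ∃ x, Γ.Avoids G₀ t x
    · obtain ⟨x, hx⟩ := hav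
      exact cornerAt_of_reaches hXv hXp hXg hsing hT1 hT3 hT4 (hT2.reaches hx)
    · exact cornerAt_of_not_avoids hXv hXp hXg hsing (not_exists.mp hav)
  rw [spanM_eq, spanMStar_eq, mulSpan, Submodule.map₂_span_span]
  refine Submodule.span_le.mpr ?_
  rintro _ ⟨_, ⟨p, y, rfl⟩, _, ⟨q, z, rfl⟩, rfl⟩
  have hyz : y * z ∈ Submodule.span R (monomials R Γ ⊤) := by rw [span_monomials]; trivial
  change vert R Γ p * y * (z * vert R Γ q) ∈ X
  have hassoc : vert R Γ p * y * (z * vert R Γ q) = vert R Γ p * (y * z) * vert R Γ q := by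
    simp only [mul_assoc]
  rw [hassoc]
  generalize y * z = c at hyz
  clear hassoc
  induction hyz using Submodule.span_induction with
  | mem c hc =>
    obtain ⟨p', l, q', m, t, hl, hm, -, rfl⟩ := hc
    by_cases hp : (p : V) = p'
    · by_cases hq : q' = q
      · subst hp hq
        rw [← mul_assoc, vert_mul_pathAux hl, mul_assoc, ghostPathAux_mul_vert hm]
        exact hall t _ _ _ _ hl hm p.2 q.2
      · rw [← ghostPathAux_mul_vert hm, mul_assoc, mul_assoc, mul_assoc, vert_mul_vert_of_ne hq,
          mul_zero, mul_zero, mul_zero]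
        exact zero_mem _
    · rw [← vert_mul_pathAux hl, ← mul_assoc, ← mul_assoc, vert_mul_vert_of_ne hp, zero_mul,
        zero_mul, zero_mul]
      exact zero_mem _
  | zero => rw [mul_zero, zero_mul]; exact zero_mem _
  | add y z _ _ hy hz => rw [mul_add, add_mul]; exact add_mem hy hz
  | smul c z _ hz => rw [mul_smul_comm, smul_mul_assoc]; exact SMulMemClass.smul_mem _ hz

end Corner

/-- The range of the homomorphism from the contracted graph lies in the corner, because each
element of its domain is a sum of elements `q_v z q_w`. -/
theorem map_mem_mulSpan {φ : LeavittPathAlgebra R (Γ.contract G₀) →ₙₐ[R] LeavittPathAlgebra R Γ}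
    (hv : ∀ p : G₀, φ (vert R (Γ.contract G₀) p) = vert R Γ (p : V))
    (c : LeavittPathAlgebra R (Γ.contract G₀)) :
    φ c ∈ mulSpan R (spanM R Γ G₀) (spanMStar R Γ G₀) := by
  have hc : c ∈ Submodule.span R (monomials R (Γ.contract G₀) ⊤) := by
    rw [span_monomials]
    trivial
  induction hc using Submodule.span_induction with
  | mem c hc =>
    obtain ⟨p, l, q, m, t, hl, hm, -, rfl⟩ := hc
    rw [← vert_mul_pathAux hl, ← ghostPathAux_mul_vert hm, map_mul, map_mul, map_mul, hv, hv]
    exact mul_mem_mulSpan p q _ _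
  | zero => rw [map_zero]; exact zero_mem _
  | add y z _ _ hy hz => rw [map_add]; exact add_mem hy hz
  | smul c z _ hz => rw [map_smul]; exact Submodule.smul_mem _ _ hz

end LeavittPathAlgebra

theorem theorem4p1 {R : Type w} [CommRing R] {V : Type u} {E : Type v} [Countable V] [Countable E]
    (Γ : DirectedGraph V E) (hhead : ∀ x : ℕ → E, ¬ Γ.IsHead x)
    (G₀ : Set V) (hsing : ∀ p, Γ.IsSingular p → p ∈ G₀)
    (hacyclic : Γ.AcyclicOn (Γ.complEdges G₀))
    (hT1 : Γ.CondT1 G₀) (hT2 : Γ.CondT2 G₀) (hT3 : Γ.CondT3 G₀) (hT4 : Γ.CondT4 G₀) :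
    AreMoritaEquivalent R (LeavittPathAlgebra R (Γ.contract G₀)) (LeavittPathAlgebra R Γ) ∧
    LeavittPathAlgebra.mulSpan R (LeavittPathAlgebra.spanMStar R Γ G₀)
      (LeavittPathAlgebra.spanM R Γ G₀) = ⊤ ∧
    ∃ φ : LeavittPathAlgebra R (Γ.contract G₀) →ₙₐ[R] LeavittPathAlgebra R Γ,
      (∀ p : G₀, φ (LeavittPathAlgebra.vert R (Γ.contract G₀) p)
        = LeavittPathAlgebra.vert R Γ (p : V)) ∧
      (∀ β : Γ.ContractedEdge G₀, φ (LeavittPathAlgebra.edge R (Γ.contract G₀) β)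
        = LeavittPathAlgebra.path R β.toFinPath) ∧
      (∀ β : Γ.ContractedEdge G₀, φ (LeavittPathAlgebra.ghost R (Γ.contract G₀) β)
        = LeavittPathAlgebra.ghostPath R β.toFinPath) ∧
      Function.Injective φ ∧
      Set.range φ = LeavittPathAlgebra.mulSpan R (LeavittPathAlgebra.spanM R Γ G₀)
        (LeavittPathAlgebra.spanMStar R Γ G₀) := by
  obtain ⟨φ, ⟨hv, he, hg⟩, -⟩ := LeavittPathAlgebra.existsUnique_lift R (Γ.contract G₀)
    (LeavittPathAlgebra.isLeavittFamily_contract (R := R) hhead hsing hacyclic hT1 hT3)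
  have hinj := LeavittPathAlgebra.injective_of_contract hv hg
  have hfull := LeavittPathAlgebra.mulSpan_spanMStar_spanM (R := R) hsing hT2
  have hrange : ∀ z, z ∈ LeavittPathAlgebra.mulSpan R (LeavittPathAlgebra.spanM R Γ G₀)
      (LeavittPathAlgebra.spanMStar R Γ G₀) ↔ ∃ c, φ c = z := by
    refine fun z => ⟨fun hz => ?_, ?_⟩
    · refine LeavittPathAlgebra.mulSpan_spanM_spanMStar_le (X := NonUnitalAlgHom.range φ)
        (fun p hp => ⟨_, hv ⟨p, hp⟩⟩) (fun p hp l hl => ?_) (fun p hp l hl => ?_)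
        hsing hT1 hT2 hT3 hT4 hz
      · obtain ⟨β, rfl, hr⟩ := hl.exists_contractedEdge hp
        obtain rfl : Γ.r (β.edges.head β.ne_nil) = p := congrArg Subtype.val hr
        exact ⟨_, he β⟩
      · obtain ⟨β, rfl, hr⟩ := hl.exists_contractedEdge hp
        obtain rfl : Γ.r (β.edges.head β.ne_nil) = p := congrArg Subtype.val hr
        exact ⟨_, hg β⟩
    · rintro ⟨c, rfl⟩
      exact LeavittPathAlgebra.map_mem_mulSpan hv c
  refine ⟨?_, hfull, φ, hv, he, hg, hinj, Set.ext fun z => (hrange z).symm⟩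
  refine areMoritaEquivalent_of_idempotents hinj (LeavittPathAlgebra.vert R (Γ.contract G₀))
    LeavittPathAlgebra.vert_mul_vert ?_ ?_ hrange hfull
  · rw [LeavittPathAlgebra.spanM_eq]
    simp only [hv]
  · rw [LeavittPathAlgebra.spanMStar_eq]
    simp only [hv]
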